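/- **Definitions.** A representation with $n$ subtrees is a pair $\langle T,\mathcal T\rangle$ of a finite tree $T$ and a family $\mathcal T=(T_1,\dots,T_n)$ of non-empty subtrees of $T$ (repetitions allowed). Its intersection graph $G(\mathcal T)$ has vertices $1,\dots,n$, and distinct $i,k$ are adjacent iff $T_i$ and $T_k$ have a common node. For an edge $e$ of $T$, $\mathcal T/e$ is the family of subtrees of the contracted tree $T/e$ that arises from $\mathcal T$ by contracting $e$. The representation is contraction-minimal if $G(\mathcal T/e)\ne G(\mathcal T)$ for every edge $e$ of $T$. A graph is chordal if it has no induced cycle of length at least $4$. $\mathcal T_j$ denotes the set of members of $\mathcal T$ that contain the node $j$. **Algorithm GenerateContractionMinimal** (input $n\ge 1$). The function NewNode picks a number $k\in\{1,\dots,n-|\mathcal T|\}$ at random, takes a new node $j'$, adds to $\mathcal T$ $k$ new subtrees consisting of $j'$ only, adds to $G$ a clique $V_{j'}$ on the $k$ corresponding new vertices, and returns $j'$. Start with $\mathcal T=\emptyset$ and $G=(\emptyset,\emptyset)$, call $j'\leftarrow$ NewNode, and let $T=(\{j'\},\emptyset)$. While $|\mathcal T|<n$: pick a node $j$ of $T$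 uniformly at random; $j'\leftarrow$ NewNode; add the node $j'$ and the edge $jj'$ to $T$; pick a proper subset $\mathcal T'$ of $\mathcal T_j$ at random; for every $T_i\in\mathcal T'$ add the node $j'$ and the edge $jj'$ to $T_i$, and add to $G$ all edges between $i$ and $V_{j'}$. Return $(\langle T,\mathcal T\rangle,G)$. Here the number $k$ and the proper subset $\mathcal T'$ are drawn from arbitrary fixed distributions, depending only on $n-|\mathcal T|$ and on $\mathcal T_j$ respectively, that give positive probability to every admissible choice and to nothing else (for instance, the uniform distributions). **Running time.** One step is charged for each addition of a single node or edge to $T$, to one subtree or to $G$, for each creation of a subtree, for each entry made in the lists of the subtrees containing a given node, for each lookup of a counter, of the size of an array or of a reference to a list, for each pass through and each end of a for-loop, and for each draw of a number or of a node; drawing a subset $\mathcal T'$ takes $1+|\mathcal T'|$ steps. **Theorem.** 1. There is a constant $C$ such that, for every $n\ge1$ and all distributions as above, every execution of the algorithm that has positive probability halts and outputs a contraction-minimal representation $\langle T,\mathcal T\rangle$ with $n$ subtrees together with its intersection graph $G=G(\mathcal T)$; this graph is chordal; and the number of steps is at most $C(n+m)$, where $m$ is the number of edges of $G$. 2. For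 every $n\ge 1$, all distributions as above and every contraction-minimal representation $\langle\bar T,\bar{\mathcal T}\rangle$ with $n$ subtrees, the algorithm outputs $\langle\bar T,\bar{\mathcal T}\rangle$ together with $G(\bar{\mathcal T})$, up to the names of the nodes of the tree and the numbering of the subtrees, with strictly positive probability. 3. For every $n\ge 1$, all distributions as above and every chordal graph $\bar G$ on $n$ vertices, the algorithm outputs a graph isomorphic to $\bar G$ with strictly positive probability. -/

import Mathlib

namespace ChordalGen

/-! ## Chordal graphs, subtree representations, contraction-minimality -/

/-- A graph is chordal if it contains no induced cycle of length 4 or more. -/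
def IsChordal {V : Type*} (G : SimpleGraph V) : Prop :=
  ∀ k : ℕ, 4 ≤ k → IsEmpty (SimpleGraph.cycleGraph k ↪g G)

/-- The equivalence relation that identifies the two endpoints of `e` and nothing else. -/
def mergeEnds {W : Type*} (e : Sym2 W) : Setoid W where
  r a b := a = b ∨ (a ∈ e ∧ b ∈ e)
  iseqv := by
    refine ⟨fun a => Or.inl rfl, ?_, ?_⟩
    · rintro a b (h | ⟨h, k⟩)
      · exact Or.inl h.symm
      · exact Or.inr ⟨k, h⟩
    · rintro a b c (rfl | ⟨h, k⟩) (rfl | ⟨h2, k2⟩)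
      · exact Or.inl rfl
      · exact Or.inr ⟨h2, k2⟩
      · exact Or.inr ⟨h, k⟩
      · exact Or.inr ⟨h, k2⟩

/-- The graph obtained from `T` by contracting `e` (loops are deleted). -/
def contractGraph {W : Type*} (T : SimpleGraph W) (e : Sym2 W) :
    SimpleGraph (Quotient (mergeEnds e)) where
  Adj x y := x ≠ y ∧ ∃ a b, T.Adj a b ∧ Quotient.mk _ a = x ∧ Quotient.mk _ b = y
  symm := ⟨fun _ _ h => ⟨h.1.symm, by
    obtain ⟨_, a, b, hab, ha, hb⟩ := h
    exact ⟨b, a, hab.symm, hb, ha⟩⟩⟩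
  loopless := ⟨fun _ h => h.1 rfl⟩

/-- The subgraph of the contracted graph that is obtained from the subgraph `S`. -/
def contractSubgraph {W : Type*} {T : SimpleGraph W} (S : T.Subgraph) (e : Sym2 W) :
    (contractGraph T e).Subgraph where
  verts := Quotient.mk _ '' S.verts
  Adj x y := x ≠ y ∧ ∃ a b, S.Adj a b ∧ Quotient.mk _ a = x ∧ Quotient.mk _ b = y
  adj_sub := by
    rintro x y ⟨h, a, b, hab, ha, hb⟩
    exact ⟨h, a, b, S.adj_sub hab, ha, hb⟩
  edge_vert := by
    rintro x y ⟨_, a, b, hab, ha, _⟩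
    exact ⟨a, S.edge_vert hab, ha⟩
  symm := ⟨by
    rintro x y ⟨h, a, b, hab, ha, hb⟩
    exact ⟨h.symm, b, a, hab.symm, hb, ha⟩⟩

/-- The vertex-intersection graph of a family of subgraphs. -/
def intersectionGraph {W ι : Type*} {T : SimpleGraph W} (S : ι → T.Subgraph) :
    SimpleGraph ι where
  Adj i k := i ≠ k ∧ ((S i).verts ∩ (S k).verts).Nonempty
  symm := ⟨fun i k h => ⟨h.1.symm, by rw [Set.inter_comm]; exact h.2⟩⟩
  loopless := ⟨fun _ h => h.1 rfl⟩

/-- A tree together with a family of `n` (non-empty) subtrees of it; repetitions are allowed. -/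
structure Representation (W : Type*) (n : ℕ) where
  tree : SimpleGraph W
  isTree : tree.IsTree
  sub : Fin n → tree.Subgraph
  connected : ∀ i, (sub i).Connected

/-- The graph represented by a representation. -/
def Representation.graph {W : Type*} {n : ℕ} (R : Representation W n) : SimpleGraph (Fin n) :=
  intersectionGraph R.sub

/-- Contracting any edge of the tree changes the represented graph. -/
def Representation.ContractionMinimal {W : Type*} {n : ℕ} (R : Representation W n) : Prop :=
  ∀ e ∈ R.tree.edgeSet,
    intersectionGraph (fun i => contractSubgraph (R.sub i) e) ≠ R.graph

/-! ## The data on which the algorithm works -/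

/-- A graph in memory: the array of its vertices and the array of its edges. (Lists play the role of
dynamic arrays: the only accesses below are appending an entry, reading the length, running through
all entries, and drawing at random.) -/
structure RawGraph where
  V : List ℕ
  E : List (ℕ × ℕ)

/-- The graph `(∅, ∅)`. -/
def RawGraph.empty : RawGraph := ⟨[], []⟩

/-- `x` and `y` are joined by a stored (undirected) edge. -/
def RawGraph.Joins (g : RawGraph) (x y : ℕ) : Prop := (x, y) ∈ g.E ∨ (y, x) ∈ g.E

/-- Under the naming `name` of vertices by numbers, `g` stores exactly the vertices and edges
of the subgraph `H`. -/
def RawGraph.Encodes {V : Type*} {G : SimpleGraph V} (g : RawGraph) (name : V → ℕ)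
    (H : G.Subgraph) : Prop :=
  {x | x ∈ g.V} = name '' H.verts ∧
  ∀ x y, g.Joins x y ↔ ∃ a b, H.Adj a b ∧ name a = x ∧ name b = y

/-- The memory of the algorithm. -/
structure Store where
  /-- the tree `T` -/
  T : RawGraph
  /-- the number of subtrees created so far; they are numbered `0, …, count - 1` -/
  count : ℕ
  /-- the subtree with a given number -/
  sub : ℕ → RawGraph
  /-- for every node `j`, the numbers of the subtrees that contain `j` -/
  through : ℕ → List ℕ
  /-- the graph `G`; its vertex `i` belongs to the subtree with number `i` -/
  G : RawGraph

/-- The initial memory. -/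
def Store.empty : Store := ⟨RawGraph.empty, 0, fun _ => RawGraph.empty, fun _ => [], RawGraph.empty⟩

/-- The tree and the subtrees in memory are those of `R`, where `node` names the nodes of the tree
and `num` numbers the subtrees. -/
def Store.EncodesRep {W : Type*} {n : ℕ} (s : Store) (R : Representation W n)
    (node : W → ℕ) (num : Fin n → ℕ) : Prop :=
  Function.Injective node ∧
  s.T.Encodes node (⊤ : R.tree.Subgraph) ∧
  Set.BijOn num Set.univ {i | i < s.count} ∧
  ∀ i, (s.sub (num i)).Encodes node (R.sub i)

/-- The graph in memory is `G`, where `num` names the vertices of `G`. -/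
def Store.EncodesGraph {V : Type*} (s : Store) (G : SimpleGraph V) (num : V → ℕ) : Prop :=
  Function.Injective num ∧ s.G.Encodes num (⊤ : G.Subgraph)

/-- The elementary operations: each changes the memory by one node, one edge or one entry. -/
inductive Op
  /-- add the node `j` to `T` -/
  | treeNode (j : ℕ)
  /-- add the edge `jk` to `T` -/
  | treeEdge (j k : ℕ)
  /-- create the subtree with the next free number, without nodes so far -/
  | newSubtree
  /-- add the node `j` to the subtree number `i` -/
  | subNode (i j : ℕ)
  /-- add the edge `jk` to the subtree number `i` -/
  | subEdge (i j k : ℕ)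
  /-- enter the subtree number `i` in the list of subtrees that contain `j` -/
  | register (i j : ℕ)
  /-- add the vertex `i` to `G` -/
  | vertex (i : ℕ)
  /-- add the edge `ik` to `G` -/
  | edge (i k : ℕ)

/-- The effect of an elementary operation. -/
def Op.apply : Op → Store → Store
  | .treeNode j, s => { s with T := ⟨j :: s.T.V, s.T.E⟩ }
  | .treeEdge j k, s => { s with T := ⟨s.T.V, (j, k) :: s.T.E⟩ }
  | .newSubtree, s =>
      { s with count := s.count + 1, sub := Function.update s.sub s.count RawGraph.empty }
  | .subNode i j, s =>
      { s with sub := Function.update s.sub i ⟨j :: (s.sub i).V, (s.sub i).E⟩ }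
  | .subEdge i j k, s =>
      { s with sub := Function.update s.sub i ⟨(s.sub i).V, (j, k) :: (s.sub i).E⟩ }
  | .register i j, s =>
      { s with through := Function.update s.through j (i :: s.through j) }
  | .vertex i, s => { s with G := ⟨i :: s.G.V, s.G.E⟩ }
  | .edge i k, s => { s with G := ⟨s.G.V, (i, k) :: s.G.E⟩ }

/-! ## Randomized computations with a step counter -/

/-- The memory together with the number of steps executed so far. -/
structure Machine where
  store : Store
  steps : ℕ

/-- Randomized computations. -/
abbrev Alg := StateT Machine PMF

/-- Spend `c` steps. -/
noncomputable def spend (c : ℕ) : Alg Unit :=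
  modify fun s => ⟨s.store, s.steps + c⟩

/-- Execute one elementary operation: one step. -/
noncomputable def exec (o : Op) : Alg Unit := do
  spend 1
  modify fun s => ⟨o.apply s.store, s.steps⟩

/-- Look up a counter, the length of an array, or (a reference to) an array: one step. -/
noncomputable def look {α : Type} (f : Store → α) : Alg α := do
  spend 1
  let s ← get
  return f s.store

/-- Draw a random element from the distribution `p`; obtaining the element `a` takes `cost a`
steps. -/
noncomputable def draw {α : Type} (p : PMF α) (cost : α → ℕ) : Alg α := do
  let a ← (liftM p : Alg α)
  spend (cost a)
  return a

/-- For all entries of a list: one step for each entry and one for the end of the list, in addition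
to the steps of the loop body. -/
noncomputable def forEach {α : Type} (body : α → Alg Unit) : List α → Alg Unit
  | [] => spend 1
  | a :: l => do
      spend 1
      body a
      forEach body l

/-- The distributions by which a number of subtrees and a proper subset are picked at random: any ones
that give every admissible choice, and nothing else, a positive probability. -/
structure RandomChoices where
  /-- picks a number in `{1, …, r}` -/
  number : ℕ → PMF ℕ
  number_support : ∀ r, 1 ≤ r → (number r).support = Set.Icc 1 r
  /-- picks a proper subset of a non-empty finite set -/
  subset : Finset ℕ → PMF (Finset ℕ)
  subset_support : ∀ A : Finset ℕ, A.Nonempty → (subset A).support = {S | S ⊂ A}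

/-- The uniform distribution on a finite set (with an irrelevant value on the empty set). -/
noncomputable def uniformOn {α : Type} [Inhabited α] (A : Finset α) : PMF α :=
  open Classical in
  if h : A.Nonempty then PMF.uniformOfFinset A h else PMF.pure default

theorem support_uniformOn {α : Type} [Inhabited α] {A : Finset α} (h : A.Nonempty) :
    (uniformOn A).support = (A : Set α) := by
  ext x
  simp [uniformOn, h]

/-- Picking every number and every proper subset uniformly at random. -/
noncomputable def RandomChoices.uniform : RandomChoices where
  number r := uniformOn (Finset.Icc 1 r)
  number_support r hr := by
    rw [support_uniformOn ⟨1, by simpa using hr⟩]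
    simp
  subset A := uniformOn A.ssubsets
  subset_support A hA := by
    rw [support_uniformOn ⟨∅, by simpa [Finset.mem_ssubsets] using hA⟩]
    ext S
    simp

noncomputable instance : Inhabited RandomChoices := ⟨RandomChoices.uniform⟩

/-! ## The algorithm -/

/-- Create `k` new subtrees that consist of the node `j` only, and a clique of `k` new vertices of
`G`, of which those in `clique` are already there. Returns the list of the clique. -/
noncomputable def newCopies (j : ℕ) : ℕ → List ℕ → Alg (List ℕ)
  | 0, clique => do
      spend 1
      return clique
  | k + 1, clique => do
      let i ← look (fun s => s.count)
      exec .newSubtree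
      exec (.subNode i j)
      exec (.register i j)
      exec (.vertex i)
      forEach (fun u => exec (.edge i u)) clique
      newCopies j k (i :: clique)

/-- The function NewNode: returns a new node and the clique of the subtrees created for it. -/
noncomputable def newNode (D : RandomChoices) (n : ℕ) : Alg (ℕ × List ℕ) := do
  let c ← look (fun s => s.count)
  let k ← draw (D.number (n - c)) (fun _ => 1)
  let j ← look (fun s => s.T.V.length)
  let clique ← newCopies j k []
  return (j, clique)

/-- One iteration of the main loop. -/
noncomputable def iteration (D : RandomChoices) (n : ℕ) : Alg Unit := do
  let nodes ← look (fun s => s.T.V)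
  let j ← draw (uniformOn nodes.toFinset) (fun _ => 1)
  let p ← newNode D n
  exec (.treeNode p.1)
  exec (.treeEdge j p.1)
  let A ← look (fun s => s.through j)
  let S ← draw (D.subset A.toFinset) (fun S => 1 + S.card)
  forEach (fun i => do
    exec (.subNode i p.1)
    exec (.subEdge i j p.1)
    exec (.register i p.1)
    forEach (fun u => exec (.edge i u)) p.2) S.toList

/-- The main loop: iterate while there are fewer than `n` subtrees. The loop is cut off after a given
number of tests of the loop condition; the result is `true` if the loop has ended by itself, because
the loop condition failed, and `false` if it was cut off. -/
noncomputable def mainLoop (D : RandomChoices) (n : ℕ) : ℕ → Alg Bool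
  | 0 => return false
  | f + 1 => do
      let c ← look (fun s => s.count)
      if c < n then do
        iteration D n
        mainLoop D n f
      else
        return true

/-- Algorithm GenerateContractionMinimal. -/
noncomputable def generateContractionMinimal (D : RandomChoices) (n : ℕ) : Alg Bool := do
  let p ← newNode D n
  exec (.treeNode p.1)
  mainLoop D n n

/-- The joint distribution of the halting flag, the final memory and the number of steps. -/
noncomputable def output (D : RandomChoices) (n : ℕ) : PMF (Bool × Machine) :=
  (generateContractionMinimal D n).run ⟨Store.empty, 0⟩

end ChordalGen

namespace ChordalGen

/-! ## Possible outcomes of randomized computations -/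

/-! Contracting an edge ab of the tree changes the intersection graph iff some subtree contains a
but not b and another contains b but not a. Contraction-minimality is thus a local condition on
edges, recorded in `IsMinRep` by `down` and `up`, with parents and roots in place of paths. An
iteration preserves it: a proper subset of the subtrees through j leaves one that misses the new
leaf, each of the k ≥ 1 new subtrees misses j, and no incidence of an old node changes
(`IsMinRep.leaf`).

Conversely, number the nodes of a contraction-minimal representation by their distance from a root
and the subtrees by their smallest nodes. The part on the nodes 0, …, τ - 1 is then a state of the
algorithm, and adding τ is an admissible iteration: by `up` some subtree is rooted at τ, and by
`down` the other subtrees through τ, which all contain the parent of τ, form a proper subset of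
those through the parent. Every admissible choice has positive probability, so an induction over the
nodes gives a possible execution (`Stores.mainLoop_reaches`).

Of two intersecting subtrees, the one with the larger root has its root in the other
(`IsMinRep.mem_of_root_le`). This gives both chordality and the Helly property. By Dirac's lemma a
chordal graph has a simplicial vertex v. In a minimal representation of the rest, the neighbours of
v share a node; v is placed on a new leaf there, or on that node itself if a leaf would violate
minimality. So every chordal graph has a contraction-minimal representation, and the previous
paragraph applies.

The invariant `Stores` ties the memory to such a rooted representation and bounds the steps: an
iteration costs a constant, plus a constant for each new vertex and each new edge of G. -/

/-- `r` is the result and the final machine of an execution of `x` that starts in `m` and has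
positive probability. -/
def Outcome {α : Type} (x : Alg α) (m : Machine) (r : α × Machine) : Prop :=
  r ∈ (x.run m).support

/-- Only the support of the output distribution matters, so probabilities are never computed. The
rules below turn membership in the support into a relation between memories. -/
theorem outcome_pure {α : Type} (a : α) (m : Machine) (r : α × Machine) :
    Outcome (pure a) m r ↔ r = (a, m) := by
  unfold Outcome
  rw [StateT.run_pure]
  exact PMF.mem_support_pure_iff _ _

theorem outcome_bind {α β : Type} (x : Alg α) (f : α → Alg β) (m : Machine) (r : β × Machine) :
    Outcome (x >>= f) m r ↔ ∃ q, Outcome x m q ∧ Outcome (f q.1) q.2 r := by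
  unfold Outcome
  rw [StateT.run_bind]
  exact PMF.mem_support_bind_iff _ _ _

theorem outcome_spend (c : ℕ) (m : Machine) (r : Unit × Machine) :
    Outcome (spend c) m r ↔ r = ((), ⟨m.store, m.steps + c⟩) :=
  PMF.mem_support_pure_iff _ _

theorem outcome_exec (o : Op) (m : Machine) (r : Unit × Machine) :
    Outcome (exec o) m r ↔ r = ((), ⟨o.apply m.store, m.steps + 1⟩) := by
  unfold exec
  rw [outcome_bind]
  constructor
  · rintro ⟨q, hq, h⟩
    rw [outcome_spend] at hq
    subst hq
    exact (PMF.mem_support_pure_iff _ _).1 h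
  · rintro rfl
    exact ⟨_, (outcome_spend _ _ _).2 rfl, (PMF.mem_support_pure_iff _ _).2 rfl⟩

theorem outcome_look {α : Type} (f : Store → α) (m : Machine) (r : α × Machine) :
    Outcome (look f) m r ↔ r = (f m.store, ⟨m.store, m.steps + 1⟩) := by
  unfold look
  rw [outcome_bind]
  have hget : ∀ (m : Machine) (q : Machine × Machine),
      Outcome (get : Alg Machine) m q ↔ q = (m, m) := fun m q => PMF.mem_support_pure_iff _ _
  constructor
  · rintro ⟨q, hq, h⟩
    rw [outcome_spend] at hq
    subst hq
    obtain ⟨q, hq, h⟩ := (outcome_bind _ _ _ _).1 h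
    rw [hget] at hq
    subst hq
    exact (outcome_pure _ _ _).1 h
  · rintro rfl
    exact ⟨_, (outcome_spend _ _ _).2 rfl, (outcome_bind _ _ _ _).2
      ⟨_, (hget _ _).2 rfl, (outcome_pure _ _ _).2 rfl⟩⟩

theorem outcome_draw {α : Type} (p : PMF α) (cost : α → ℕ) (m : Machine) (r : α × Machine) :
    Outcome (draw p cost) m r ↔
      r.1 ∈ p.support ∧ r.2 = ⟨m.store, m.steps + cost r.1⟩ := by
  have hl : ∀ (m : Machine) (q : α × Machine),
      Outcome (liftM p : Alg α) m q ↔ q.1 ∈ p.support ∧ q.2 = m := by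
    intro m q
    have h : Outcome (liftM p : Alg α) m q ↔ q ∈ (p.bind fun a => PMF.pure (a, m)).support :=
      Iff.rfl
    rw [h, PMF.mem_support_bind_iff]
    constructor
    · rintro ⟨a, ha, h⟩
      rw [PMF.mem_support_pure_iff] at h
      subst h
      exact ⟨ha, rfl⟩
    · rintro ⟨ha, h⟩
      exact ⟨q.1, ha, (PMF.mem_support_pure_iff _ _).2 (Prod.ext rfl h)⟩
  unfold draw
  simp only [outcome_bind, hl, outcome_spend, outcome_pure]
  constructor
  · rintro ⟨q, ⟨h1, h2⟩, _, rfl, rfl⟩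
    exact ⟨h1, by simp [h2]⟩
  · rintro ⟨h1, h2⟩
    exact ⟨(r.1, m), ⟨h1, rfl⟩, _, rfl, Prod.ext rfl h2⟩

theorem outcome_spend_bind {β : Type} (c : ℕ) (f : Unit → Alg β) (m : Machine) (r : β × Machine) :
    Outcome (spend c >>= f) m r ↔ Outcome (f ()) ⟨m.store, m.steps + c⟩ r := by
  simp [outcome_bind, outcome_spend]

theorem outcome_exec_bind {β : Type} (o : Op) (f : Unit → Alg β) (m : Machine) (r : β × Machine) :
    Outcome (exec o >>= f) m r ↔ Outcome (f ()) ⟨o.apply m.store, m.steps + 1⟩ r := by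
  simp [outcome_bind, outcome_exec]

theorem outcome_look_bind {α β : Type} (g : Store → α) (f : α → Alg β) (m : Machine)
    (r : β × Machine) :
    Outcome (look g >>= f) m r ↔ Outcome (f (g m.store)) ⟨m.store, m.steps + 1⟩ r := by
  simp [outcome_bind, outcome_look]

theorem outcome_draw_bind {α β : Type} (p : PMF α) (cost : α → ℕ) (f : α → Alg β) (m : Machine)
    (r : β × Machine) :
    Outcome (draw p cost >>= f) m r ↔
      ∃ a ∈ p.support, Outcome (f a) ⟨m.store, m.steps + cost a⟩ r := by
  rw [outcome_bind]
  constructor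
  · rintro ⟨⟨a, _⟩, hq, h⟩
    obtain ⟨ha, hm⟩ := (outcome_draw _ _ _ _).1 hq
    simp only at hm
    subst hm
    exact ⟨a, ha, h⟩
  · rintro ⟨a, ha, h⟩
    exact ⟨(a, _), (outcome_draw _ _ _ _).2 ⟨ha, rfl⟩, h⟩

/-- A distribution has nonempty support. For procedures without random choices this supplies an
execution; its effect is then read off from the lemmas about all executions. -/
theorem exists_outcome {α : Type} (x : Alg α) (m : Machine) : ∃ r, Outcome x m r :=
  (x.run m).support_nonempty

theorem outcome_forEach_nil {α : Type} (body : α → Alg Unit) (m : Machine) (r : Unit × Machine) :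
    Outcome (forEach body []) m r ↔ r = ((), ⟨m.store, m.steps + 1⟩) := by
  unfold forEach
  exact outcome_spend _ _ _

theorem outcome_forEach_cons {α : Type} (body : α → Alg Unit) (a : α) (l : List α) (m : Machine)
    (r : Unit × Machine) :
    Outcome (forEach body (a :: l)) m r ↔
      ∃ q, Outcome (body a) ⟨m.store, m.steps + 1⟩ q ∧ Outcome (forEach body l) q.2 r := by
  rw [forEach]
  simp only [outcome_bind, outcome_spend]
  constructor
  · rintro ⟨_, rfl, h⟩
    exact h
  · intro h
    exact ⟨_, rfl, h⟩

theorem outcome_forEach_edge (i : ℕ) (l : List ℕ) (m : Machine) (r : Unit × Machine)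
    (h : Outcome (forEach (fun u => exec (.edge i u)) l) m r) :
    r.2 = ⟨{ m.store with
        G := ⟨m.store.G.V, (l.map fun u => (i, u)).reverse ++ m.store.G.E⟩ },
      m.steps + 2 * l.length + 1⟩ := by
  induction l generalizing m with
  | nil =>
    rw [outcome_forEach_nil] at h
    subst h
    rfl
  | cons a l ih =>
    rw [outcome_forEach_cons] at h
    obtain ⟨q, hq, h⟩ := h
    rw [outcome_exec] at hq
    subst hq
    rw [ih _ h]
    simp only [Op.apply, List.map_cons, List.reverse_cons, List.append_assoc, List.cons_append,
      List.nil_append, List.length_cons, Machine.mk.injEq, true_and]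
    omega

/-! ## The effect of the procedures on the memory -/

/-- The list of edges stores no undirected edge twice. -/
def EdgesNodup (E : List (ℕ × ℕ)) : Prop := (E.map fun e => s(e.1, e.2)).Nodup

/-- Edges at the common end `i` are told apart by their other ends, and by assumption none of them
is stored in either orientation. -/
theorem EdgesNodup.star {E : List (ℕ × ℕ)} (hE : EdgesNodup E) {i : ℕ} {l : List ℕ} (hl : l.Nodup)
    (h : ∀ u ∈ l, (i, u) ∉ E ∧ (u, i) ∉ E) :
    EdgesNodup ((l.map fun u => (i, u)).reverse ++ E) := by
  unfold EdgesNodup at *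
  rw [List.map_append, List.nodup_append]
  refine ⟨?_, hE, ?_⟩
  · rw [List.map_reverse, List.nodup_reverse, List.map_map]
    refine hl.map ?_
    intro a b hab
    exact Sym2.congr_right.1 hab
  · intro a ha b hb hab
    subst hab
    simp only [List.map_reverse, List.map_map, List.mem_reverse, List.mem_map,
      Function.comp] at ha hb
    obtain ⟨u, hu, rfl⟩ := ha
    obtain ⟨⟨x, y⟩, hxy, h'⟩ := hb
    simp only [Sym2.eq_iff] at h'
    rcases h' with ⟨rfl, rfl⟩ | ⟨rfl, rfl⟩
    · exact (h _ hu).1 hxy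
    · exact (h _ hu).2 hxy

/-- The effect of creating `k` copies of the node `j`. -/
structure CopiesMade (j k : ℕ) (clique : List ℕ) (m : Machine) (l : List ℕ) (m' : Machine) :
    Prop where
  list : l = (List.range' m.store.count k).reverse ++ clique
  tree : m'.store.T = m.store.T
  count : m'.store.count = m.store.count + k
  sub : ∀ i, m'.store.sub i =
    if m.store.count ≤ i ∧ i < m.store.count + k then ⟨[j], []⟩ else m.store.sub i
  through : m'.store.through = Function.update m.store.through j
    ((List.range' m.store.count k).reverse ++ m.store.through j)
  vertices : m'.store.G.V = (List.range' m.store.count k).reverse ++ m.store.G.V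
  edges : ∀ x y, (x, y) ∈ m'.store.G.E ↔ (x, y) ∈ m.store.G.E ∨
    (m.store.count ≤ x ∧ x < m.store.count + k) ∧ (y ∈ clique ∨ m.store.count ≤ y ∧ y < x)
  nodup : EdgesNodup m.store.G.E → (∀ x y, (x, y) ∈ m.store.G.E →
    x < m.store.count ∧ y < m.store.count) → clique.Nodup → (∀ u ∈ clique, u < m.store.count) →
    EdgesNodup m'.store.G.E
  length_le : m.store.G.E.length ≤ m'.store.G.E.length
  steps : m'.steps + 2 * m.store.G.E.length = m.steps + 6 * k + 1 + 2 * m'.store.G.E.length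

/-- Induction on `k` with a variable clique: each copy is joined to all earlier ones, so edges run
from larger to smaller numbers. A copy costs six steps plus two per edge; the step count is stated
additively to avoid subtraction of natural numbers. -/
theorem copiesMade_of_outcome (j k : ℕ) (clique : List ℕ) (m : Machine) (r : List ℕ × Machine)
    (h : Outcome (newCopies j k clique) m r) : CopiesMade j k clique m r.1 r.2 := by
  induction k generalizing clique m with
  | zero =>
    simp only [newCopies, outcome_spend_bind, outcome_pure] at h
    subst h
    constructor <;> simp
    exact fun h _ _ _ => h
  | succ k ih =>
    simp only [newCopies, outcome_look_bind, outcome_exec_bind] at h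
    obtain ⟨q, hq, h⟩ := (outcome_bind _ _ _ _).1 h
    have hq2 := outcome_forEach_edge _ _ _ _ hq
    have H := ih _ _ h
    rw [hq2] at H
    simp only [Op.apply] at H
    have hr : (List.range' m.store.count (k + 1)).reverse =
        (List.range' (m.store.count + 1) k).reverse ++ [m.store.count] := by
      rw [List.range'_succ, List.reverse_cons]
    constructor
    · rw [H.list, hr]
      simp
    · exact H.tree
    · rw [H.count]
      simp only
      omega
    · intro i
      rw [H.sub]
      simp only [Function.update_apply]
      by_cases hi : i = m.store.count
      · subst hi
        simp [RawGraph.empty]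
      · by_cases h2 : m.store.count + 1 ≤ i ∧ i < m.store.count + 1 + k
        · rw [if_pos h2, if_pos (by omega)]
        · rw [if_neg h2, if_neg (by omega)]
          simp only [hi, if_false]
          rw [if_neg (by omega)]
    · rw [H.through, hr]
      simp
    · rw [H.vertices, hr]
      simp
    · intro x y
      rw [H.edges]
      simp only [List.mem_append, List.mem_reverse, List.mem_map, Prod.mk.injEq, List.mem_cons]
      constructor
      · rintro ((⟨u, hu, rfl, rfl⟩ | h) | ⟨h1, (rfl | h) | h⟩)
        · exact Or.inr ⟨by omega, Or.inl hu⟩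
        · exact Or.inl h
        · exact Or.inr ⟨by omega, Or.inr (by omega)⟩
        · exact Or.inr ⟨by omega, Or.inl h⟩
        · exact Or.inr ⟨by omega, Or.inr (by omega)⟩
      · rintro (h | ⟨h1, h2⟩)
        · exact Or.inl (Or.inr h)
        · by_cases hx : x = m.store.count
          · rcases h2 with h2 | h2
            · exact Or.inl (Or.inl ⟨y, h2, hx.symm, rfl⟩)
            · omega
          · refine Or.inr ⟨by omega, ?_⟩
            rcases h2 with h2 | h2
            · exact Or.inl (Or.inr h2)
            · by_cases hy : y = m.store.count
              · exact Or.inl (Or.inl hy)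
              · exact Or.inr (by omega)
    · intro h1 h2 h3 h4
      refine H.nodup (h1.star h3 ?_) ?_ ?_ ?_
      · intro u hu
        exact ⟨fun h => by have := h2 _ _ h; omega, fun h => by have := h2 _ _ h; omega⟩
      · intro x y hxy
        simp only [List.mem_append, List.mem_reverse, List.mem_map, Prod.mk.injEq] at hxy
        rcases hxy with ⟨u, hu, rfl, rfl⟩ | h
        · have := h4 _ hu
          simp only
          omega
        · have := h2 _ _ h
          simp only
          omega
      · refine List.nodup_cons.2 ⟨fun h => ?_, h3⟩
        have := h4 _ h
        omega
      · intro u hu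
        rcases List.mem_cons.1 hu with rfl | hu
        · simp
        · have := h4 _ hu
          simp only
          omega
    · have := H.length_le
      simp only [List.length_append, List.length_reverse, List.length_map] at this
      omega
    · have := H.steps
      simp only [List.length_append, List.length_reverse, List.length_map] at this
      omega

theorem outcome_newNode (D : RandomChoices) (n : ℕ) (m : Machine) (r : (ℕ × List ℕ) × Machine) :
    Outcome (newNode D n) m r ↔ ∃ k ∈ (D.number (n - m.store.count)).support,
      r.1.1 = m.store.T.V.length ∧
      Outcome (newCopies m.store.T.V.length k []) ⟨m.store, m.steps + 3⟩ (r.1.2, r.2) := by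
  simp only [newNode, outcome_look_bind, outcome_draw_bind]
  refine exists_congr fun k => and_congr_right fun _ => ?_
  simp only [outcome_bind, outcome_pure]
  constructor
  · rintro ⟨q, hq, rfl⟩
    exact ⟨rfl, hq⟩
  · rintro ⟨h1, h2⟩
    exact ⟨_, h2, Prod.ext (Prod.ext h1 rfl) rfl⟩

/-- The effect of extending the subtrees with numbers in `S` by the new leaf `t` at `j`. -/
structure Extended (j t : ℕ) (clique S : List ℕ) (m m' : Machine) : Prop where
  tree : m'.store.T = m.store.T
  count : m'.store.count = m.store.count
  sub : ∀ i, m'.store.sub i =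
    if i ∈ S then ⟨t :: (m.store.sub i).V, (j, t) :: (m.store.sub i).E⟩ else m.store.sub i
  through : m'.store.through = Function.update m.store.through t
    (S.reverse ++ m.store.through t)
  vertices : m'.store.G.V = m.store.G.V
  edges : ∀ x y, (x, y) ∈ m'.store.G.E ↔ (x, y) ∈ m.store.G.E ∨ x ∈ S ∧ y ∈ clique
  nodup : EdgesNodup m.store.G.E → clique.Nodup →
    (∀ i ∈ S, ∀ u ∈ clique, (i, u) ∉ m.store.G.E ∧ (u, i) ∉ m.store.G.E) →
    (∀ i ∈ S, i ∉ clique) → EdgesNodup m'.store.G.E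
  length : m'.store.G.E.length = m.store.G.E.length + S.length * clique.length
  steps : m'.steps = m.steps + 5 * S.length + 2 * (S.length * clique.length) + 1

/-- As `S` has no repetitions, each subtree is extended once. It costs five steps plus two for each
edge to the clique. -/
theorem extended_of_outcome (j t : ℕ) (clique S : List ℕ) (hS : S.Nodup) (m : Machine)
    (r : Unit × Machine)
    (h : Outcome (forEach (fun i => do
      exec (.subNode i t)
      exec (.subEdge i j t)
      exec (.register i t)
      forEach (fun u => exec (.edge i u)) clique) S) m r) : Extended j t clique S m r.2 := by
  induction S generalizing m with
  | nil =>
    rw [outcome_forEach_nil] at h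
    subst h
    constructor <;> simp
    intro h _
    exact h
  | cons i S ih =>
    rw [outcome_forEach_cons] at h
    obtain ⟨q, hq, h⟩ := h
    simp only [outcome_exec_bind] at hq
    have hq2 := outcome_forEach_edge _ _ _ _ hq
    have hi := (List.nodup_cons.1 hS).1
    have H := ih (List.nodup_cons.1 hS).2 _ h
    rw [hq2] at H
    simp only [Op.apply] at H
    constructor
    · exact H.tree
    · exact H.count
    · intro x
      rw [H.sub]
      simp only [Function.update_apply]
      by_cases hx : x = i
      · subst hx
        simp [hi]
      · simp [hx]
    · rw [H.through]
      simp
    · exact H.vertices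
    · intro x y
      rw [H.edges]
      simp only [List.mem_append, List.mem_reverse, List.mem_map, Prod.mk.injEq, List.mem_cons]
      constructor
      · rintro ((⟨u, hu, rfl, rfl⟩ | h) | ⟨h1, h2⟩)
        · exact Or.inr ⟨Or.inl rfl, hu⟩
        · exact Or.inl h
        · exact Or.inr ⟨Or.inr h1, h2⟩
      · rintro (h | ⟨rfl | h1, h2⟩)
        · exact Or.inl (Or.inr h)
        · exact Or.inl (Or.inl ⟨y, h2, rfl, rfl⟩)
        · exact Or.inr ⟨h1, h2⟩
    · intro h1 h2 h3 h4
      refine H.nodup (h1.star h2 fun u hu => h3 i (by simp) u hu) h2 ?_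
        fun i hi => h4 i (List.mem_cons_of_mem _ hi)
      intro a ha u hu
      have h5 := h3 a (List.mem_cons_of_mem _ ha) u hu
      have h6 := h4 a (List.mem_cons_of_mem _ ha)
      simp only [List.mem_append, List.mem_reverse, List.mem_map, Prod.mk.injEq, not_or, h5,
        not_false_eq_true, and_true]
      constructor
      · rintro ⟨_, _, rfl, _⟩
        exact hi ha
      · rintro ⟨_, h7, _, rfl⟩
        exact h6 h7
    · rw [H.length]
      simp only [List.length_append, List.length_reverse, List.length_map, List.length_cons]
      ring
    · rw [H.steps]
      simp only [List.length_cons]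
      ring

/-- The random choices are exactly `j`, `k` and `S`. The 5 steps are the lookup and draw of a node
and the three steps of NewNode before the copies; the later 3 are two operations on the tree and one
lookup. -/
theorem outcome_iteration (D : RandomChoices) (n : ℕ) (m : Machine) (r : Unit × Machine) :
    Outcome (iteration D n) m r ↔
      ∃ j ∈ (uniformOn m.store.T.V.toFinset).support,
      ∃ k ∈ (D.number (n - m.store.count)).support,
      ∃ l m₁, Outcome (newCopies m.store.T.V.length k []) ⟨m.store, m.steps + 5⟩ (l, m₁) ∧
      ∃ S ∈ (D.subset (m₁.store.through j).toFinset).support,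
      Outcome (forEach (fun i => do
        exec (.subNode i m.store.T.V.length)
        exec (.subEdge i j m.store.T.V.length)
        exec (.register i m.store.T.V.length)
        forEach (fun u => exec (.edge i u)) l) S.toList)
        ⟨{ m₁.store with T := ⟨m.store.T.V.length :: m₁.store.T.V,
            (j, m.store.T.V.length) :: m₁.store.T.E⟩ }, m₁.steps + 3 + (1 + S.card)⟩ r := by
  simp only [iteration, outcome_look_bind, outcome_draw_bind]
  refine exists_congr fun j => and_congr_right fun _ => ?_
  rw [outcome_bind]
  simp only [outcome_newNode, outcome_look_bind, outcome_draw_bind, outcome_exec_bind]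
  constructor
  · rintro ⟨⟨⟨t, l⟩, m₁⟩, ⟨k, hk, ht, hq⟩, S, hS, h⟩
    subst ht
    exact ⟨k, hk, l, m₁, hq, S, hS, h⟩
  · rintro ⟨k, hk, l, m₁, hq, S, hS, h⟩
    exact ⟨((_, l), m₁), ⟨k, hk, rfl, hq⟩, S, hS, h⟩

/-! ## Memories that store a rooted tree and subtrees -/

/-- The memory stores the tree on the nodes `0, …, t - 1` in which `p x` is the parent of the node
`x ≠ 0`, the subtrees with the numbers `0, …, c - 1`, where the subtree `i` contains the node `x` iff
`M i x`, and their intersection graph; and few steps have been executed. -/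
structure Stores (t c : ℕ) (p : ℕ → ℕ) (M : ℕ → ℕ → Prop) (m : Machine) : Prop where
  nodes_length : m.store.T.V.length = t
  nodes : ∀ x, x ∈ m.store.T.V ↔ x < t
  tree_edges : ∀ x y, (x, y) ∈ m.store.T.E ↔ 0 < y ∧ y < t ∧ x = p y
  count : m.store.count = c
  index_lt : ∀ i x, x < t → M i x → i < c
  sub_nodes : ∀ i, i < c → ∀ x, x ∈ (m.store.sub i).V ↔ x < t ∧ M i x
  sub_edges : ∀ i, i < c → ∀ x y, (x, y) ∈ (m.store.sub i).E ↔
    0 < y ∧ y < t ∧ x = p y ∧ M i x ∧ M i y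
  through : ∀ x, x < t → ∀ i, i ∈ m.store.through x ↔ M i x
  through_nil : ∀ x, t ≤ x → m.store.through x = []
  vertices : ∀ i, i ∈ m.store.G.V ↔ i < c
  joins : ∀ i k, m.store.G.Joins i k ↔ i ≠ k ∧ ∃ x < t, M i x ∧ M k x
  nodup : EdgesNodup m.store.G.E
  steps : m.steps ≤ 18 * c + 8 * m.store.G.E.length

theorem Stores.edge_lt {t c : ℕ} {p : ℕ → ℕ} {M : ℕ → ℕ → Prop} {m : Machine}
    (h : Stores t c p M m) (x y : ℕ) (hxy : (x, y) ∈ m.store.G.E) : x < c ∧ y < c := by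
  obtain ⟨_, z, hz, h1, h2⟩ := (h.joins x y).1 (Or.inl hxy)
  exact ⟨h.index_lt _ _ hz h1, h.index_lt _ _ hz h2⟩

/-- The first node. -/
theorem stores_first {k : ℕ} (hk : 1 ≤ k) {p : ℕ → ℕ} {M : ℕ → ℕ → Prop}
    (hM : ∀ i, M i 0 ↔ i < k) {l : List ℕ} {m₁ : Machine}
    (h : CopiesMade 0 k [] ⟨Store.empty, 3⟩ l m₁) :
    Stores 1 k p M ⟨{ m₁.store with T := ⟨0 :: m₁.store.T.V, m₁.store.T.E⟩ }, m₁.steps + 1⟩ := by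
  obtain ⟨-, hT, hc, hsub, hth, hV, hE, hnd, hle, hst⟩ := h
  simp only [Store.empty, RawGraph.empty, Nat.zero_le, true_and, zero_add, List.not_mem_nil,
    false_or, List.append_nil, List.length_nil, mul_zero, add_zero] at hT hc hsub hth hV hE hnd hle hst
  constructor
  · simp [hT]
  · simp [hT]
  · intro x y
    simp only [hT, List.not_mem_nil, false_iff]
    omega
  · exact hc
  · intro i x hx h
    obtain rfl : x = 0 := by omega
    exact (hM i).1 h
  · intro i hi x
    simp only [hsub, if_pos hi, List.mem_singleton, Nat.lt_one_iff]
    constructor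
    · rintro rfl
      exact ⟨rfl, (hM i).2 hi⟩
    · exact fun h => h.1
  · intro i hi x y
    simp only [hsub, if_pos hi, List.not_mem_nil, false_iff]
    omega
  · intro x hx i
    obtain rfl : x = 0 := by omega
    simp [hth, hM]
  · intro x hx
    simp only [hth]
    rw [Function.update_of_ne (by omega)]
  · intro i
    simp [hV]
  · intro i j
    simp only [RawGraph.Joins, hE]
    constructor
    · intro h
      exact ⟨by omega, 0, by omega, (hM i).2 (by omega), (hM j).2 (by omega)⟩
    · rintro ⟨hij, x, hx, h1, h2⟩
      obtain rfl : x = 0 := by omega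
      have := (hM i).1 h1
      have := (hM j).1 h2
      omega
  · exact hnd (by simp [EdgesNodup]) (by simp) (by simp) (by simp)
  · simp only
    omega

/-- A new leaf. -/
theorem Stores.leaf {t c : ℕ} {p : ℕ → ℕ} {M : ℕ → ℕ → Prop} {m : Machine} (h : Stores t c p M m)
    (ht : 0 < t) {k : ℕ} (hk : 1 ≤ k) {j : ℕ} (hj : j < t) {S : Finset ℕ} (hS : ∀ i ∈ S, M i j)
    {p' : ℕ → ℕ} {M' : ℕ → ℕ → Prop} (hp : ∀ x < t, p' x = p x) (hpt : p' t = j)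
    (hM : ∀ i, ∀ x < t, M' i x ↔ M i x) (hMt : ∀ i, M' i t ↔ i ∈ S ∨ (c ≤ i ∧ i < c + k))
    (hpl : ∀ x, 0 < x → x < t → p x < t)
    {l : List ℕ} {m₁ m₂ : Machine} (h₁ : CopiesMade t k [] ⟨m.store, m.steps + 6⟩ l m₁)
    (h₂ : Extended j t l S.toList
      ⟨{ m₁.store with T := ⟨t :: m₁.store.T.V, (j, t) :: m₁.store.T.E⟩ },
        m₁.steps + 3 + (1 + S.card)⟩ m₂) :
    Stores (t + 1) (c + k) p' M' m₂ := by
  obtain ⟨hl, hT, hc, hsub, hth, hV, hE, hnd, hle, hst⟩ := h₁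
  obtain ⟨hT2, hc2, hsub2, hth2, hV2, hE2, hnd2, hlen2, hst2⟩ := h₂
  have hSc : ∀ i ∈ S, i < c := fun i hi => h.index_lt i j hj (hS i hi)
  simp only [h.count, List.not_mem_nil, false_or, List.append_nil] at hl hT hc hsub hth hV hE hnd hle hst
  have hml : ∀ u, u ∈ l ↔ c ≤ u ∧ u < c + k := fun u => by simp [hl, List.mem_range'_1]
  have hll : l.length = k := by simp [hl]
  have hln : l.Nodup := by
    rw [hl, List.nodup_reverse]
    exact List.nodup_range'
  simp only [Finset.mem_toList, Finset.length_toList, hll] at hsub2 hE2 hnd2 hlen2 hst2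
  have hltE := h.edge_lt
  have hE3 : ∀ x y, (x, y) ∈ m₂.store.G.E ↔ (x, y) ∈ m.store.G.E ∨
      ((c ≤ x ∧ x < c + k) ∧ c ≤ y ∧ y < x) ∨ x ∈ S ∧ c ≤ y ∧ y < c + k := by
    intro x y
    rw [hE2, hE, hml, or_assoc]
  have hnew : ∀ i, c ≤ i → ∀ x < t, ¬ M i x := fun i hi x hx hM => by
    have := h.index_lt i x hx hM
    omega
  constructor
  · rw [hT2]
    simp [hT, h.nodes_length]
  · intro x
    rw [hT2]
    simp only [hT, List.mem_cons, h.nodes]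
    omega
  · intro x y
    rw [hT2]
    simp only [hT, List.mem_cons, Prod.mk.injEq, h.tree_edges]
    constructor
    · rintro (⟨rfl, rfl⟩ | ⟨h1, h2, rfl⟩)
      · exact ⟨ht, by omega, hpt.symm⟩
      · exact ⟨h1, by omega, (hp y h2).symm⟩
    · rintro ⟨h1, h2, h3⟩
      by_cases hy : y = t
      · subst hy
        exact Or.inl ⟨h3.trans hpt, rfl⟩
      · exact Or.inr ⟨h1, by omega, h3.trans (hp y (by omega))⟩
  · rw [hc2]
    simp [hc]
  · intro i x hx hi
    by_cases hxt : x = t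
    · subst hxt
      rcases (hMt i).1 hi with h1 | h1
      · have := hSc i h1
        omega
      · omega
    · have := h.index_lt i x (by omega) ((hM i x (by omega)).1 hi)
      omega
  · intro i hi x
    rw [hsub2]
    simp only [hsub]
    by_cases hiS : i ∈ S
    · have hic := hSc i hiS
      rw [if_pos hiS, if_neg (by omega), List.mem_cons, h.sub_nodes i hic]
      constructor
      · rintro (rfl | ⟨h1, h2⟩)
        · exact ⟨by omega, (hMt i).2 (Or.inl hiS)⟩
        · exact ⟨by omega, (hM i x h1).2 h2⟩
      · rintro ⟨h1, h2⟩
        by_cases hxt : x = t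
        · exact Or.inl hxt
        · exact Or.inr ⟨by omega, (hM i x (by omega)).1 h2⟩
    · rw [if_neg hiS]
      by_cases hic : i < c
      · rw [if_neg (by omega), h.sub_nodes i hic]
        constructor
        · rintro ⟨h1, h2⟩
          exact ⟨by omega, (hM i x h1).2 h2⟩
        · rintro ⟨h1, h2⟩
          by_cases hxt : x = t
          · subst hxt
            rcases (hMt i).1 h2 with h3 | h3
            · exact absurd h3 hiS
            · omega
          · exact ⟨by omega, (hM i x (by omega)).1 h2⟩
      · rw [if_pos (by omega), List.mem_singleton]
        constructor
        · rintro rfl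
          exact ⟨by omega, (hMt i).2 (Or.inr (by omega))⟩
        · rintro ⟨h1, h2⟩
          by_contra hxt
          exact hnew i (by omega) x (by omega) ((hM i x (by omega)).1 h2)
  · intro i hi x y
    rw [hsub2]
    simp only [hsub]
    have hold : ∀ {y}, 0 < y → y < t → (x = p y ∧ M i x ∧ M i y ↔ x = p' y ∧ M' i x ∧ M' i y) := by
      intro y hy0 hy
      rw [hp y hy, hM i y hy]
      refine and_congr_right fun hx => ?_
      rw [hM i x (hx ▸ hpl y hy0 hy)]
    by_cases hiS : i ∈ S
    · have hic := hSc i hiS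
      rw [if_pos hiS, if_neg (by omega), List.mem_cons, h.sub_edges i hic, Prod.mk.injEq]
      constructor
      · rintro (⟨rfl, rfl⟩ | ⟨h1, h2, h3⟩)
        · exact ⟨ht, by omega, hpt.symm, (hM i x hj).2 (hS i hiS), (hMt i).2 (Or.inl hiS)⟩
        · exact ⟨h1, by omega, (hold h1 h2).1 h3⟩
      · rintro ⟨h1, h2, h3⟩
        by_cases hyt : y = t
        · subst hyt
          exact Or.inl ⟨h3.1.trans hpt, rfl⟩
        · exact Or.inr ⟨h1, by omega, (hold h1 (by omega)).2 h3⟩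
    · rw [if_neg hiS]
      -- A subtree outside `S` has no edge to the leaf: an old one misses `t`, and a new one misses
      -- the parent `j`.
      have hyt : M' i (p' y) → M' i y → y < t + 1 → y < t := by
        intro h1 h2 h3
        by_contra hyt
        obtain rfl : y = t := by omega
        rcases (hMt i).1 h2 with h4 | h4
        · exact hiS h4
        · rw [hpt] at h1
          exact hnew i h4.1 j hj ((hM i j hj).1 h1)
      by_cases hic : i < c
      · rw [if_neg (by omega), h.sub_edges i hic]
        constructor
        · rintro ⟨h1, h2, h3⟩
          exact ⟨h1, by omega, (hold h1 h2).1 h3⟩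
        · rintro ⟨h1, h2, h3⟩
          have hy := hyt (h3.1 ▸ h3.2.1) h3.2.2 h2
          exact ⟨h1, hy, (hold h1 hy).2 h3⟩
      · rw [if_pos (by omega)]
        simp only [List.not_mem_nil, false_iff]
        rintro ⟨h1, h2, h3⟩
        have hy := hyt (h3.1 ▸ h3.2.1) h3.2.2 h2
        exact hnew i (by omega) y hy ((hM i y hy).1 h3.2.2)
  · intro x hx i
    rw [hth2]
    by_cases hxt : x = t
    · subst hxt
      simp only [Function.update_self, hth, h.through_nil _ le_rfl, hMt, List.mem_append, List.mem_reverse,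
        Finset.mem_toList, List.mem_range'_1, List.not_mem_nil, or_false]
    · rw [Function.update_of_ne hxt]
      simp only [hth]
      rw [Function.update_of_ne hxt, h.through x (by omega), hM i x (by omega)]
  · intro x hx
    rw [hth2, Function.update_of_ne (by omega)]
    simp only [hth]
    rw [Function.update_of_ne (by omega), h.through_nil _ (by omega)]
  · intro i
    rw [hV2]
    simp only [hV, List.mem_append, List.mem_reverse, List.mem_range'_1, h.vertices]
    omega
  · intro i k'
    have hj' := h.joins i k'
    unfold RawGraph.Joins at hj' ⊢
    simp only [hE3]
    constructor
    · intro hh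
      by_cases hold : (i, k') ∈ m.store.G.E ∨ (k', i) ∈ m.store.G.E
      · obtain ⟨h1, x, hx, h2, h3⟩ := hj'.1 hold
        exact ⟨h1, x, by omega, (hM _ x hx).2 h2, (hM _ x hx).2 h3⟩
      · push Not at hold
        simp only [hold, false_or] at hh
        refine ⟨?_, t, by omega, ?_⟩
        · rintro rfl
          rcases hh with (hh | hh) | (hh | hh)
          · omega
          · have := hSc _ hh.1
            omega
          · omega
          · have := hSc _ hh.1
            omega
        · rw [hMt, hMt]
          rcases hh with (hh | hh) | (hh | hh)
          · exact ⟨Or.inr (by omega), Or.inr (by omega)⟩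
          · exact ⟨Or.inl hh.1, Or.inr (by omega)⟩
          · exact ⟨Or.inr (by omega), Or.inr (by omega)⟩
          · exact ⟨Or.inr (by omega), Or.inl hh.1⟩
    · rintro ⟨hne, x, hx, h1, h2⟩
      have hold : (∃ x < t, M i x ∧ M k' x) →
          ((i, k') ∈ m.store.G.E ∨ (k', i) ∈ m.store.G.E) := fun hx => hj'.2 ⟨hne, hx⟩
      by_cases hxt : x = t
      · subst hxt
        rw [hMt] at h1 h2
        rcases h1 with h1 | h1 <;> rcases h2 with h2 | h2
        -- Two extended subtrees already meet in `j`, so meeting in the leaf requires no new edge.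
        · rcases hold ⟨j, hj, hS _ h1, hS _ h2⟩ with h3 | h3
          · exact Or.inl (Or.inl h3)
          · exact Or.inr (Or.inl h3)
        · exact Or.inl (Or.inr (Or.inr ⟨h1, h2⟩))
        · exact Or.inr (Or.inr (Or.inr ⟨h2, h1⟩))
        · omega
      · rcases hold ⟨x, by omega, (hM _ x (by omega)).1 h1, (hM _ x (by omega)).1 h2⟩ with h3 | h3
        · exact Or.inl (Or.inl h3)
        · exact Or.inr (Or.inl h3)
  -- Every added edge has an end with number at least `c`, whereas edges stored before have both
  -- ends below `c`.
  · refine hnd2 (hnd h.nodup hltE (by simp) (by simp)) hln ?_ ?_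
    · intro i hi u hu
      have h1 := hSc i hi
      have h2 := (hml u).1 hu
      rw [hE, hE]
      constructor
      · rintro (h3 | h3)
        · have := hltE _ _ h3
          omega
        · omega
      · rintro (h3 | h3)
        · have := hltE _ _ h3
          omega
        · omega
    · intro i hi hu
      have h1 := hSc i hi
      have h2 := (hml i).1 hu
      omega
  · have h1 := h.steps
    -- The cost is 12 + 6k + 6|S| + 2|S|k, plus 2 per edge inside the new clique. Since k ≥ 1, the
    -- first two terms are at most 18k and the next two at most 8|S|k, where |S|k counts the edges
    -- between old and new vertices.
    have h2 : S.card ≤ S.card * k := Nat.le_mul_of_pos_right _ (by omega)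
    omega

/-! ## Rooted trees on initial segments of the natural numbers -/

/-- `p x` is the parent of the node `x ≠ 0` of a tree on `0, …, t - 1`; the subtree with index
`i ∈ I` consists of the nodes `x` with `M i x`; and of two adjacent nodes none is contained in all
subtrees that contain the other one. -/
structure IsMinRep {ι : Type*} (t : ℕ) (p : ℕ → ℕ) (I : Set ι) (M : ι → ℕ → Prop) : Prop where
  pos : 0 < t
  parent_lt : ∀ x, 0 < x → x < t → p x < x
  node_lt : ∀ i x, M i x → x < t
  index_mem : ∀ i x, M i x → i ∈ I
  root : ∀ i ∈ I, ∃ r, M i r ∧ ∀ x, M i x → x ≠ r → r < x ∧ M i (p x)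
  down : ∀ x, 0 < x → x < t → ∃ i, M i (p x) ∧ ¬ M i x
  up : ∀ x, 0 < x → x < t → ∃ i, M i x ∧ ¬ M i (p x)
  nonempty : ∃ i, M i 0

namespace IsMinRep

variable {ι : Type*} {t : ℕ} {p : ℕ → ℕ} {I : Set ι} {M : ι → ℕ → Prop}

theorem root_lt_of_mem {T : ℕ → Prop} {r : ℕ} (h : ∀ x, T x → x ≠ r → r < x ∧ T (p x)) {x : ℕ}
    (hx : T x) : r ≤ x := by
  by_cases hxr : x = r
  · exact hxr.ge
  · exact (h x hx hxr).1.le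

/-- The higher of the roots of two intersecting subtrees is a common node. -/
theorem mem_of_root_le (hR : IsMinRep t p I M) {i k : ι} {r s x : ℕ}
    (hr : ∀ x, M i x → x ≠ r → r < x ∧ M i (p x)) (hs : ∀ x, M k x → x ≠ s → s < x ∧ M k (p x))
    (hrs : r ≤ s) (hi : M i x) (hk : M k x) : M i s := by
  -- Climb from the common node `x` towards `s`: as long as `x` differs from `s`, it exceeds both
  -- roots, and its parent is a smaller common node.
  induction x using Nat.strong_induction_on with
  | _ x ih =>
    by_cases hxs : x = s
    · exact hxs ▸ hi
    · have h1 := hs x hk hxs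
      have h2 := hr x hi (by omega)
      exact ih (p x) (hR.parent_lt x (by omega) (hR.node_lt _ _ hi)) h2.2 h1.2

/-- One node that lies in all subtrees of a finite nonempty set. -/
theorem single (I : Set ι) (hI : I.Nonempty) :
    IsMinRep 1 p I fun i x => i ∈ I ∧ x = 0 where
  pos := one_pos
  parent_lt x h1 h2 := by omega
  node_lt i x h := by omega
  index_mem i x h := h.1
  root i hi := ⟨0, ⟨hi, rfl⟩, fun x h1 h2 => absurd h1.2 h2⟩
  down x h1 h2 := by omega
  up x h1 h2 := by omega
  nonempty := ⟨hI.some, hI.some_mem, rfl⟩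

/-- A new leaf. -/
theorem leaf (hR : IsMinRep t p I M) {j : ℕ} (hj : j < t) {S N : Set ι} (hS : ∀ i ∈ S, M i j)
    (hjS : ∃ i, M i j ∧ i ∉ S) (hN : N.Nonempty) (hNI : ∀ i ∈ N, i ∉ I) :
    IsMinRep (t + 1) (Function.update p t j) (I ∪ N)
      fun i x => M i x ∨ x = t ∧ (i ∈ S ∨ i ∈ N) := by
  have hSI : ∀ i ∈ S, i ∈ I := fun i hi => hR.index_mem i j (hS i hi)
  have hMt : ∀ i, ¬ M i t := fun i h => absurd (hR.node_lt _ _ h) (lt_irrefl t)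
  have hpx : ∀ x, x < t → Function.update p t j x = p x := fun x hx =>
    Function.update_of_ne (by omega) _ _
  constructor
  · omega
  · intro x h1 h2
    by_cases hx : x = t
    · subst hx
      simpa using hj
    · rw [hpx x (by omega)]
      exact hR.parent_lt x h1 (by omega)
  · rintro i x (h | h)
    · have := hR.node_lt _ _ h
      omega
    · omega
  · rintro i x (h | ⟨-, h | h⟩)
    · exact Or.inl (hR.index_mem _ _ h)
    · exact Or.inl (hSI i h)
    · exact Or.inr h
  · rintro i (hi | hi)
    · obtain ⟨r, hr, h⟩ := hR.root i hi
      have hrt := hR.node_lt _ _ hr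
      refine ⟨r, Or.inl hr, ?_⟩
      rintro x (hx | ⟨rfl, hx⟩) hxr
      · rw [hpx x (hR.node_lt _ _ hx)]
        exact ⟨(h x hx hxr).1, Or.inl (h x hx hxr).2⟩
      · refine ⟨hrt, Or.inl ?_⟩
        rw [Function.update_self]
        exact hS i (hx.resolve_right fun h => hNI i h hi)
    · refine ⟨t, Or.inr ⟨rfl, Or.inr hi⟩, ?_⟩
      rintro x (hx | ⟨rfl, hx⟩) hxr
      · exact absurd (hR.index_mem _ _ hx) (hNI i hi)
      · exact absurd rfl hxr
  · intro x h1 h2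
    by_cases hx : x = t
    · subst hx
      -- Properness of the chosen subset gives `down` at the new edge; the new subtrees give `up`
      -- below.
      obtain ⟨i, hi, hiS⟩ := hjS
      refine ⟨i, Or.inl (by simpa using hi), ?_⟩
      rintro (h | ⟨-, h | h⟩)
      · exact hMt i h
      · exact hiS h
      · exact hNI i h (hR.index_mem _ _ hi)
    · obtain ⟨i, hi, h⟩ := hR.down x h1 (by omega)
      exact ⟨i, Or.inl (by rwa [hpx x (by omega)]), by simp [h, hx]⟩
  · intro x h1 h2
    by_cases hx : x = t
    · subst hx
      obtain ⟨i, hi⟩ := hN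
      refine ⟨i, Or.inr ⟨rfl, Or.inr hi⟩, ?_⟩
      rw [Function.update_self]
      rintro (h | ⟨h, -⟩)
      · exact hNI i hi (hR.index_mem _ _ h)
      · omega
    · obtain ⟨i, hi, h⟩ := hR.up x h1 (by omega)
      refine ⟨i, Or.inl hi, ?_⟩
      rw [hpx x (by omega)]
      have := hR.parent_lt x h1 (by omega)
      rintro (h' | ⟨h', -⟩)
      · exact h h'
      · omega
  · obtain ⟨i, hi⟩ := hR.nonempty
    exact ⟨i, Or.inl hi⟩

/-- A new subtree that consists of one of the old nodes. -/
theorem insert_single (hR : IsMinRep t p I M) {j : ℕ} (hj : j < t) {v : ι} (hv : v ∉ I) :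
    IsMinRep t p (insert v I) fun i x => M i x ∨ x = j ∧ i = v := by
  have hMv : ∀ x, ¬ M v x := fun x h => hv (hR.index_mem _ _ h)
  constructor
  · exact hR.pos
  · exact hR.parent_lt
  · rintro i x (h | ⟨rfl, -⟩)
    · exact hR.node_lt _ _ h
    · exact hj
  · rintro i x (h | ⟨-, rfl⟩)
    · exact Or.inr (hR.index_mem _ _ h)
    · exact Or.inl rfl
  · rintro i (rfl | hi)
    · refine ⟨j, Or.inr ⟨rfl, rfl⟩, ?_⟩
      rintro x (h | ⟨h, -⟩) hx
      · exact absurd h (hMv x)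
      · exact absurd h hx
    · obtain ⟨r, hr, h⟩ := hR.root i hi
      refine ⟨r, Or.inl hr, ?_⟩
      rintro x (hx | ⟨-, rfl⟩) hxr
      · exact ⟨(h x hx hxr).1, Or.inl (h x hx hxr).2⟩
      · exact absurd hi hv
  · intro x h1 h2
    obtain ⟨i, hi, h⟩ := hR.down x h1 h2
    exact ⟨i, Or.inl hi, fun h' => h'.elim h fun h'' => hMv _ (h''.2 ▸ hi)⟩
  · intro x h1 h2
    obtain ⟨i, hi, h⟩ := hR.up x h1 h2
    exact ⟨i, Or.inl hi, fun h' => h'.elim h fun h'' => hMv _ (h''.2 ▸ hi)⟩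
  · obtain ⟨i, hi⟩ := hR.nonempty
    exact ⟨i, Or.inl hi⟩

theorem exists_mem (hR : IsMinRep t p I M) {x : ℕ} (hx : x < t) : ∃ i, M i x := by
  by_cases h : x = 0
  · exact h ▸ hR.nonempty
  · obtain ⟨i, hi, -⟩ := hR.up x (by omega) hx
    exact ⟨i, hi⟩

/-! ### Helly property and chordality. -/

/-- Pairwise intersecting subtrees have a common node. -/
theorem exists_common (hR : IsMinRep t p I M) (K : Finset ι) (hKI : ∀ i ∈ K, i ∈ I)
    (hK : ∀ i ∈ K, ∀ k ∈ K, ∃ x, M i x ∧ M k x) : ∃ j < t, ∀ i ∈ K, M i j := by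
  rcases K.eq_empty_or_nonempty with rfl | hne
  · exact ⟨0, hR.pos, by simp⟩
  · have hroot : ∀ i, ∃ r, i ∈ I → M i r ∧ ∀ x, M i x → x ≠ r → r < x ∧ M i (p x) := by
      intro i
      by_cases hi : i ∈ I
      · obtain ⟨r, hr⟩ := hR.root i hi
        exact ⟨r, fun _ => hr⟩
      · exact ⟨0, fun h => absurd h hi⟩
    choose r hr using hroot
    -- The largest root lies in every member of the family.
    obtain ⟨k, hk, hmax⟩ := K.exists_max_image r hne
    refine ⟨r k, hR.node_lt _ _ (hr k (hKI k hk)).1, fun i hi => ?_⟩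
    obtain ⟨x, h1, h2⟩ := hK i hi k hk
    exact hR.mem_of_root_le (hr i (hKI i hi)).2 (hr k (hKI k hk)).2 (hmax i hi) h1 h2

/-- The intersection graph is chordal. -/
theorem isChordal (hR : IsMinRep t p I M) {G : SimpleGraph ι} (hI : ∀ i, i ∈ I)
    (hG : ∀ i k, G.Adj i k ↔ i ≠ k ∧ ∃ x, M i x ∧ M k x) : IsChordal G := by
  intro n hn
  refine ⟨fun f => ?_⟩
  choose r hr using fun i => hR.root i (hI i)
  obtain ⟨m, rfl⟩ : ∃ m, n = m + 4 := ⟨n - 4, by omega⟩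
  -- On the cycle, take a subtree with the largest root. Both neighbours contain this root, so they
  -- are adjacent and form a chord.
  obtain ⟨a, -, ha⟩ := Finset.exists_max_image Finset.univ (fun a => r (f a))
    Finset.univ_nonempty
  have h1 : (SimpleGraph.cycleGraph (m + 4)).Adj (a + 1) a := by
    rw [SimpleGraph.cycleGraph_adj]
    simp
  have h2 : (SimpleGraph.cycleGraph (m + 4)).Adj (a - 1) a := by
    rw [SimpleGraph.cycleGraph_adj]
    simp
  have key : ∀ b, (SimpleGraph.cycleGraph (m + 4)).Adj b a → M (f b) (r (f a)) := by
    intro b hb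
    obtain ⟨-, x, hx1, hx2⟩ := (hG _ _).1 (f.map_adj_iff.2 hb)
    exact hR.mem_of_root_le (hr _).2 (hr _).2 (ha b (Finset.mem_univ _)) hx1 hx2
  -- The neighbours `a + 1` and `a - 1` differ by 2, which modulo `m + 4` is none of 0, 1 and -1.
  have hv1 : ((1 : Fin (m + 4)) : ℕ) = 1 := rfl
  have hv2 : ((1 + 1 : Fin (m + 4)) : ℕ) = 2 := by
    rw [Fin.val_add, hv1, Nat.mod_eq_of_lt (by omega)]
  have hv3 : ((1 + 1 + 1 : Fin (m + 4)) : ℕ) = 3 := by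
    rw [Fin.val_add, hv1, hv2, Nat.mod_eq_of_lt (by omega)]
  have h3 : a + 1 ≠ a - 1 := by
    intro h
    have h' : (1 + 1 : Fin (m + 4)) = 0 := by
      rw [eq_sub_iff_add_eq, add_assoc] at h
      exact left_eq_add.1 h.symm
    rw [h'] at hv2
    simp at hv2
  have h5 : (SimpleGraph.cycleGraph (m + 4)).Adj (a + 1) (a - 1) :=
    f.map_adj_iff.1 ((hG _ _).2 ⟨f.injective.ne h3, _, key _ h1, key _ h2⟩)
  rw [SimpleGraph.cycleGraph_adj] at h5
  rcases h5 with h5 | h5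
  · have h' : (1 + 1 : Fin (m + 4)) = 1 := by
      calc (1 + 1 : Fin (m + 4)) = a + 1 - (a - 1) := by abel
        _ = 1 := h5
    rw [h'] at hv2
    omega
  · have h' : (1 + 1 + 1 : Fin (m + 4)) = 0 := by
      nth_rewrite 1 [← h5]
      abel
    rw [h'] at hv3
    simp at hv3

/-! ### From parent functions to trees and subtrees as graphs. -/

/-- The tree. -/
def tree (hR : IsMinRep t p I M) : SimpleGraph (Fin t) where
  Adj a b := (0 < b.val ∧ a.val = p b) ∨ (0 < a.val ∧ b.val = p a)
  symm := ⟨fun _ _ h => h.symm⟩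
  loopless := ⟨fun a h => by
    have := fun h0 => hR.parent_lt a h0 a.2
    omega⟩

/-- Passing to parents leads to 0, so the graph is connected. Each edge is determined by its end
that is the child, a number in `1, …, t - 1`, so there are at most `t - 1` edges. -/
theorem tree_isTree (hR : IsMinRep t p I M) : hR.tree.IsTree := by
  have hc : hR.tree.Connected := by
    have h0 : ∀ x (hx : x < t), hR.tree.Reachable ⟨x, hx⟩ ⟨0, hR.pos⟩ := by
      intro x
      induction x using Nat.strong_induction_on with
      | _ x ih =>
        intro hx
        by_cases h : x = 0
        · subst h
          exact SimpleGraph.Reachable.refl _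
        · have hp := hR.parent_lt x (by omega) hx
          have hadj : hR.tree.Adj ⟨x, hx⟩ ⟨p x, by omega⟩ := Or.inr ⟨by simp only; omega, rfl⟩
          exact hadj.reachable.trans (ih (p x) hp (by omega))
    have : Nonempty (Fin t) := ⟨⟨0, hR.pos⟩⟩
    exact ⟨fun a b => (h0 a a.2).trans (h0 b b.2).symm⟩
  rw [SimpleGraph.isTree_iff_connected_and_card]
  refine ⟨hc, ?_⟩
  have h1 := hc.card_vert_le_card_edgeSet_add_one
  have h2 : Nat.card hR.tree.edgeSet ≤ t - 1 := by
    have hsub : hR.tree.edgeSet ⊆ (fun x : ℕ => if h : x < t ∧ p x < t then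
        s((⟨x, h.1⟩ : Fin t), ⟨p x, h.2⟩) else s(⟨0, hR.pos⟩, ⟨0, hR.pos⟩)) ''
        (Finset.Ico 1 t : Finset ℕ) := by
      intro e
      induction e using Sym2.ind with
      | _ a b =>
        rintro (⟨h, h'⟩ | ⟨h, h'⟩)
        · have hb : b.val < t ∧ p b < t := ⟨b.2, h' ▸ a.2⟩
          refine ⟨b, Finset.mem_coe.2 (Finset.mem_Ico.2 ⟨h, b.2⟩), ?_⟩
          refine (dif_pos hb).trans (Sym2.eq_iff.2 (Or.inr ⟨rfl, Fin.ext h'.symm⟩))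
        · have hb : a.val < t ∧ p a < t := ⟨a.2, h' ▸ b.2⟩
          refine ⟨a, Finset.mem_coe.2 (Finset.mem_Ico.2 ⟨h, a.2⟩), ?_⟩
          refine (dif_pos hb).trans (Sym2.eq_iff.2 (Or.inl ⟨rfl, Fin.ext h'.symm⟩))
    have h3 := Set.ncard_le_ncard hsub ((Finset.finite_toSet _).image _)
    have h4 := Set.ncard_image_le (f := (fun x : ℕ => if h : x < t ∧ p x < t then
        s((⟨x, h.1⟩ : Fin t), ⟨p x, h.2⟩) else s(⟨0, hR.pos⟩, ⟨0, hR.pos⟩)))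
        (Finset.finite_toSet (Finset.Ico 1 t))
    rw [Set.ncard_coe_finset, Nat.card_Ico] at h4
    rw [Nat.card_coe_set_eq]
    omega
  have := hR.pos
  rw [Nat.card_fin] at h1 ⊢
  omega

/-- The subtree with index `i`. -/
def subtree (hR : IsMinRep t p I M) (i : ι) : hR.tree.Subgraph :=
  (⊤ : hR.tree.Subgraph).induce {x | M i x}

theorem subtree_connected (hR : IsMinRep t p I M) {i : ι} (hi : i ∈ I) :
    (hR.subtree i).Connected := by
  obtain ⟨r, hr, h⟩ := hR.root i hi
  have hrt := hR.node_lt _ _ hr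
  have h0 : ∀ x (hx : x < t) (hM : M i x),
      (hR.subtree i).coe.Reachable ⟨⟨x, hx⟩, hM⟩ ⟨⟨r, hrt⟩, hr⟩ := by
    intro x
    induction x using Nat.strong_induction_on with
    | _ x ih =>
      intro hx hM
      by_cases hxr : x = r
      · subst hxr
        exact SimpleGraph.Reachable.refl _
      · obtain ⟨h1, h2⟩ := h x hM hxr
        have hp := hR.parent_lt x (by omega) hx
        have hadj : (hR.subtree i).coe.Adj ⟨⟨x, hx⟩, hM⟩ ⟨⟨p x, by omega⟩, h2⟩ :=
          ⟨hM, h2, Or.inr ⟨by simp only; omega, rfl⟩⟩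
        exact hadj.reachable.trans (ih (p x) hp (by omega) h2)
  have : Nonempty (hR.subtree i).verts := ⟨⟨⟨r, hrt⟩, hr⟩⟩
  rw [SimpleGraph.Subgraph.connected_iff']
  exact ⟨fun a b => (h0 a.1.1 a.1.2 a.2).trans (h0 b.1.1 b.1.2 b.2).symm⟩

/-- The representation. -/
def rep {n : ℕ} {M : Fin n → ℕ → Prop} (hR : IsMinRep t p Set.univ M) :
    Representation (Fin t) n where
  tree := hR.tree
  isTree := hR.tree_isTree
  sub := hR.subtree
  connected i := hR.subtree_connected (Set.mem_univ i)

theorem rep_graph_adj {n : ℕ} {M : Fin n → ℕ → Prop} (hR : IsMinRep t p Set.univ M) (i k : Fin n) :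
    hR.rep.graph.Adj i k ↔ i ≠ k ∧ ∃ x, M i x ∧ M k x := by
  refine and_congr_right fun _ => ?_
  constructor
  · rintro ⟨x, h1, h2⟩
    exact ⟨x, h1, h2⟩
  · rintro ⟨x, h1, h2⟩
    exact ⟨⟨x, hR.node_lt _ _ h1⟩, h1, h2⟩

/-- The witnesses of `down` and `up` at an edge become adjacent when it is contracted. They were
disjoint: the `up` witness is rooted at the child, so a common node would put the child into the
`down` witness. -/
theorem rep_contractionMinimal {n : ℕ} {M : Fin n → ℕ → Prop} (hR : IsMinRep t p Set.univ M) :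
    hR.rep.ContractionMinimal := by
  have key : ∀ a b : Fin t, 0 < b.val → a.val = p b →
      intersectionGraph (fun i => contractSubgraph (hR.rep.sub i) s(a, b)) ≠ hR.rep.graph := by
    intro a b hb hab h
    obtain ⟨i, hi, hi'⟩ := hR.down b hb b.2
    obtain ⟨k, hk, hk'⟩ := hR.up b hb b.2
    have hik : i ≠ k := by
      rintro rfl
      exact hi' hk
    have hadj : (intersectionGraph (fun i => contractSubgraph (hR.rep.sub i) s(a, b))).Adj i k := by
      refine ⟨hik, Quotient.mk _ a, ⟨a, ?_, rfl⟩, ⟨b, hk, ?_⟩⟩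
      · change M i a
        rwa [hab]
      · exact Quotient.sound (Or.inr ⟨by simp, by simp⟩)
    rw [h, rep_graph_adj] at hadj
    obtain ⟨-, x, h1, h2⟩ := hadj
    obtain ⟨r, hr, hri⟩ := hR.root i (Set.mem_univ i)
    obtain ⟨s, hs, hsk⟩ := hR.root k (Set.mem_univ k)
    have hsb : s = b := by
      by_contra hne
      exact hk' (hsk b hk (Ne.symm hne)).2
    subst hsb
    have h3 := root_lt_of_mem hri hi
    have h4 := hR.parent_lt b hb b.2
    exact hi' (hR.mem_of_root_le hri hsk (by omega) h1 h2)
  intro e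
  induction e using Sym2.ind with
  | _ a b =>
    rintro (⟨h, h'⟩ | ⟨h, h'⟩)
    · exact key a b h h'
    · rw [Sym2.eq_swap]
      exact key b a h h'

end IsMinRep

/-! ## Chordal graphs have representations -/

theorem cycleGraph_adj_of_lt {n : ℕ} {u w : Fin n} (h : u < w) :
    (SimpleGraph.cycleGraph n).Adj u w ↔ w.val = u + 1 ∨ (u.val = 0 ∧ w.val + 1 = n) := by
  rw [SimpleGraph.cycleGraph_adj', Fin.coe_sub_iff_lt.2 h, Fin.sub_val_of_le h.le]
  have := Fin.lt_def.1 h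
  omega

/-- A chordless path whose ends, but no inner nodes, are adjacent to a further vertex, makes an
induced cycle. -/
theorem not_isChordal_of_path {V : Type*} {G : SimpleGraph V} {L : ℕ} (hL : 2 ≤ L) (f : ℕ → V)
    (v : V) (hf : ∀ i j, i < j → j ≤ L → f i ≠ f j) (hfv : ∀ i ≤ L, f i ≠ v)
    (hadj : ∀ i j, i < j → j ≤ L → (G.Adj (f i) (f j) ↔ j = i + 1))
    (hv : ∀ i ≤ L, (G.Adj (f i) v ↔ i = 0 ∨ i = L)) : ¬ IsChordal G := by
  intro hG
  let g : Fin (L + 2) → V := fun i => if i.val ≤ L then f i else v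
  have hg : ∀ i j : Fin (L + 2), i < j →
      g i ≠ g j ∧ (G.Adj (g i) (g j) ↔ (SimpleGraph.cycleGraph (L + 2)).Adj i j) := by
    intro i j hij
    rw [cycleGraph_adj_of_lt hij]
    have hlt := Fin.lt_def.1 hij
    have hi : i.val ≤ L := by omega
    by_cases hj : j.val ≤ L
    · simp only [g, if_pos hi, if_pos hj]
      refine ⟨hf _ _ hlt hj, ?_⟩
      rw [hadj _ _ hlt hj]
      omega
    · simp only [g, if_pos hi, if_neg hj]
      refine ⟨hfv _ hi, ?_⟩
      rw [hv _ hi]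
      omega
  refine (hG (L + 2) (by omega)).false ⟨⟨g, ?_⟩, ?_⟩
  · intro i j hij
    rcases lt_trichotomy i j with h | h | h
    · exact absurd hij (hg i j h).1
    · exact h
    · exact absurd hij.symm (hg j i h).1
  · intro i j
    rcases lt_trichotomy i j with h | h | h
    · exact (hg i j h).2
    · subst h
      simp
    · rw [SimpleGraph.adj_comm, SimpleGraph.adj_comm _ i j]
      exact (hg j i h).2

/-- The edges of `G` between vertices of `B`. -/
def edgesWithin {V : Type*} (G : SimpleGraph V) (B : Set V) : SimpleGraph V where
  Adj a b := G.Adj a b ∧ a ∈ B ∧ b ∈ B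
  symm := ⟨fun _ _ h => ⟨h.1.symm, h.2.2, h.2.1⟩⟩
  loopless := ⟨fun _ h => h.1.ne rfl⟩

theorem edgesWithin_mono {V : Type*} (G : SimpleGraph V) {B C : Set V} (h : B ⊆ C) :
    edgesWithin G B ≤ edgesWithin G C :=
  fun _ _ hab => ⟨hab.1, h hab.2.1, h hab.2.2⟩

/-- Two neighbours of `v` that are joined by a path among non-neighbours of `v` are adjacent. -/
theorem IsChordal.adj_of_reachable {V : Type*} {G : SimpleGraph V} (hG : IsChordal G) {B : Set V}
    {v x y : V} (hvx : G.Adj v x) (hvy : G.Adj v y) (hxy : x ≠ y)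
    (hB : ∀ b ∈ B, b ≠ v ∧ ¬ G.Adj b v)
    (hr : (edgesWithin G (B ∪ {x, y})).Reachable x y) : G.Adj x y := by
  by_contra hnadj
  set K := edgesWithin G (B ∪ {x, y}) with hK
  obtain ⟨w, hw⟩ := hr.exists_walk_length_eq_dist
  have hL : 1 < K.dist x y := hr.one_lt_dist_of_ne_of_not_adj hxy fun h => hnadj h.1
  -- A shortest walk in the induced graph has its i-th vertex at distance i. Hence its vertices are
  -- distinct and it is chordless in `G`.
  have hd : ∀ i ≤ w.length, K.dist x (w.getVert i) = i := by
    intro i hi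
    have h1 := SimpleGraph.dist_le (w.take i)
    have h2 := SimpleGraph.dist_le (w.drop i)
    rw [w.take_length] at h1
    rw [w.drop_length] at h2
    have h3 := (w.take i).reachable.dist_triangle_left y
    omega
  have hend : w.getVert w.length = y := w.getVert_length
  have hmem : ∀ i ≤ w.length, w.getVert i ∈ B ∪ {x, y} := by
    intro i hi
    cases i with
    | zero => simp
    | succ i => exact (w.adj_getVert_succ (i := i) (by omega)).2.2
  have hin : ∀ i, i ≠ 0 → i < w.length → w.getVert i ∈ B := by
    intro i h0 hi
    have hdi := hd i hi.le
    rcases hmem i hi.le with h | h | h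
    · exact h
    · rw [h, SimpleGraph.dist_self] at hdi
      omega
    · rw [Set.mem_singleton_iff.1 h] at hdi
      omega
  refine not_isChordal_of_path (L := w.length) (by omega) w.getVert v ?_ ?_ ?_ ?_ hG
  · intro i j hij hj h
    have h1 := hd i (by omega)
    have h2 := hd j hj
    rw [h] at h1
    omega
  · intro i hi h
    by_cases h0 : i = 0
    · subst h0
      rw [w.getVert_zero] at h
      exact hvx.ne h.symm
    · by_cases h1 : i = w.length
      · rw [h1, hend] at h
        exact hvy.ne h.symm
      · exact (hB _ (hin i h0 (by omega))).1 h
  · intro i j hij hj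
    constructor
    · intro h
      have hadj : K.Adj (w.getVert i) (w.getVert j) := ⟨h, hmem i (by omega), hmem j hj⟩
      have h1 := hadj.diff_dist_adj (u := x)
      rw [hd i (by omega), hd j hj] at h1
      omega
    · rintro rfl
      exact (w.adj_getVert_succ (by omega)).1
  · intro i hi
    by_cases h0 : i = 0
    · subst h0
      simp [hvx.symm]
    · by_cases h1 : i = w.length
      · rw [h1, hend]
        simp [hvy.symm]
      · simp [h0, h1, (hB _ (hin i h0 (by omega))).2]

/-! ### Simplicial vertices. -/

/-- The neighbours of `u` in `U` are pairwise adjacent. -/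
def IsSimplicialIn {V : Type*} (G : SimpleGraph V) (U : Finset V) (u : V) : Prop :=
  ∀ a ∈ U, ∀ b ∈ U, G.Adj u a → G.Adj u b → a ≠ b → G.Adj a b

/-- Dirac's lemma: a vertex of a chordal graph that is not adjacent to all others is non-adjacent to
some simplicial vertex. -/
theorem IsChordal.exists_isSimplicialIn_not_adj {V : Type*} {G : SimpleGraph V} (hG : IsChordal G)
    (U : Finset V) : ∀ v ∈ U, (∃ w ∈ U, w ≠ v ∧ ¬ G.Adj v w) →
      ∃ u ∈ U, u ≠ v ∧ ¬ G.Adj v u ∧ IsSimplicialIn G U u := by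
  classical
  induction U using Finset.strongInduction with
  | H U ih =>
    rintro v hv ⟨w₀, hw₀U, hw₀v, hw₀⟩
    set B : Set V := {b | b ∈ U ∧ b ≠ v ∧ ¬ G.Adj v b} with hBdef
    -- `H` is a component of the non-neighbours of `v`, and `S` is the set of neighbours of `v`
    -- attached to it. `S` is a clique by chordality, and vertices of `H` have no neighbours in `U`
    -- outside `H ∪ S`. So it suffices to find a vertex of `H` that is simplicial in `H ∪ S`, a
    -- smaller set since it omits `v`.
    set H : Finset V := U.filter fun b => b ∈ B ∧ (edgesWithin G B).Reachable w₀ b with hH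
    set S : Finset V := U.filter fun s => G.Adj v s ∧ ∃ h ∈ H, G.Adj h s with hS
    have hHB : ∀ h ∈ H, h ∈ B := fun h hh => (Finset.mem_filter.1 hh).2.1
    have hHU : ∀ h ∈ H, h ∈ U := fun h hh => (Finset.mem_filter.1 hh).1
    have hw₀H : w₀ ∈ H := Finset.mem_filter.2 ⟨hw₀U, ⟨hw₀U, hw₀v, hw₀⟩, SimpleGraph.Reachable.refl _⟩
    have hclosed : ∀ h ∈ H, ∀ a ∈ U, G.Adj h a → a ∈ H ∪ S := by
      intro h hh a ha hadj
      have hhB := hHB h hh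
      by_cases hva : G.Adj v a
      · exact Finset.mem_union_right _ (Finset.mem_filter.2 ⟨ha, hva, h, hh, hadj⟩)
      · have haB : a ∈ B := by
          refine ⟨ha, ?_, hva⟩
          rintro rfl
          exact hhB.2.2 hadj.symm
        refine Finset.mem_union_left _ (Finset.mem_filter.2 ⟨ha, haB, ?_⟩)
        have h1 : (edgesWithin G B).Adj h a := ⟨hadj, hhB, haB⟩
        exact (Finset.mem_filter.1 hh).2.2.trans h1.reachable
    have hclique : ∀ s ∈ S, ∀ s' ∈ S, s ≠ s' → G.Adj s s' := by
      intro x hx y hy hxy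
      obtain ⟨-, hvx, h, hh, hhx⟩ := Finset.mem_filter.1 hx
      obtain ⟨-, hvy, k, hk, hky⟩ := Finset.mem_filter.1 hy
      refine hG.adj_of_reachable (B := B) hvx hvy hxy
        (fun b hb => ⟨hb.2.1, fun h => hb.2.2 h.symm⟩) ?_
      have h1 : (edgesWithin G (B ∪ {x, y})).Adj x h :=
        ⟨hhx.symm, by simp, Or.inl (hHB h hh)⟩
      have h2 : (edgesWithin G (B ∪ {x, y})).Adj k y := ⟨hky, Or.inl (hHB k hk), by simp⟩
      have h3 : (edgesWithin G B).Reachable h k :=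
        (Finset.mem_filter.1 hh).2.2.symm.trans (Finset.mem_filter.1 hk).2.2
      exact h1.reachable.trans ((h3.mono (edgesWithin_mono G Set.subset_union_left)).trans
        h2.reachable)
    have hvH : v ∉ H := fun h => (hHB v h).2.1 rfl
    have hvS : v ∉ S := fun h => (Finset.mem_filter.1 h).2.1.ne rfl
    have hlift : ∀ u ∈ H, IsSimplicialIn G (H ∪ S) u → IsSimplicialIn G U u :=
      fun u hu h a ha b hb hua hub hab =>
        h a (hclosed u hu a ha hua) b (hclosed u hu b hb hub) hua hub hab
    suffices ∃ u ∈ H, IsSimplicialIn G (H ∪ S) u by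
      obtain ⟨u, hu, h⟩ := this
      exact ⟨u, hHU u hu, (hHB u hu).2.1, (hHB u hu).2.2, hlift u hu h⟩
    have hsub : H ∪ S ⊂ U := by
      refine Finset.ssubset_iff_of_subset (Finset.union_subset (Finset.filter_subset _ _)
        (Finset.filter_subset _ _)) |>.2 ⟨v, hv, ?_⟩
      exact fun h => (Finset.mem_union.1 h).elim hvH hvS
    -- If `S` is completely joined to `H`, a vertex simplicial in `H` will do. Otherwise apply
    -- induction to `H ∪ S` and some `s` with a non-neighbour in `H`: the simplicial vertex found is
    -- not adjacent to `s`, hence not in the clique `S`.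
    by_cases hall : ∀ s ∈ S, ∀ h ∈ H, G.Adj s h
    · have hsimp : ∃ u ∈ H, IsSimplicialIn G H u := by
        by_cases hcomp : ∀ a ∈ H, ∀ b ∈ H, a ≠ b → G.Adj a b
        · exact ⟨w₀, hw₀H, fun a ha b hb _ _ hab => hcomp a ha b hb hab⟩
        · push Not at hcomp
          obtain ⟨a, ha, b, hb, hab, hnab⟩ := hcomp
          obtain ⟨u, hu, -, -, h⟩ := ih H (lt_of_le_of_lt Finset.subset_union_left hsub) a ha
            ⟨b, hb, hab.symm, hnab⟩
          exact ⟨u, hu, h⟩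
      obtain ⟨u, hu, h⟩ := hsimp
      refine ⟨u, hu, fun a ha b hb hua hub hab => ?_⟩
      rcases Finset.mem_union.1 ha with ha | ha <;> rcases Finset.mem_union.1 hb with hb | hb
      · exact h a ha b hb hua hub hab
      · exact (hall b hb a ha).symm
      · exact hall a ha b hb
      · exact hclique a ha b hb hab
    · push Not at hall
      obtain ⟨s, hs, h, hh, hsh⟩ := hall
      have hsv := (Finset.mem_filter.1 hs).2.1
      have hhs : h ≠ s := by
        rintro rfl
        exact (hHB h hh).2.2 hsv
      obtain ⟨u, hu, hus, hsu, hsimp⟩ := ih (H ∪ S) hsub s (Finset.mem_union_right _ hs)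
        ⟨h, Finset.mem_union_left _ hh, hhs, hsh⟩
      refine ⟨u, ?_, hsimp⟩
      rcases Finset.mem_union.1 hu with hu | hu
      · exact hu
      · exact absurd (hclique s hs u hu hus.symm) hsu

theorem IsChordal.exists_isSimplicialIn {V : Type*} {G : SimpleGraph V} (hG : IsChordal G)
    {U : Finset V} (hU : U.Nonempty) : ∃ u ∈ U, IsSimplicialIn G U u := by
  by_cases hcomp : ∀ a ∈ U, ∀ b ∈ U, a ≠ b → G.Adj a b
  · exact ⟨hU.choose, hU.choose_spec, fun a ha b hb _ _ hab => hcomp a ha b hb hab⟩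
  · push Not at hcomp
    obtain ⟨a, ha, b, hb, hab, hnab⟩ := hcomp
    obtain ⟨u, hu, -, -, h⟩ := hG.exists_isSimplicialIn_not_adj U a ha ⟨b, hb, hab.symm, hnab⟩
    exact ⟨u, hu, h⟩

/-- Every chordal graph is the intersection graph of a contraction-minimal representation. -/
theorem IsChordal.exists_isMinRep {V : Type*} {G : SimpleGraph V} (hG : IsChordal G)
    (U : Finset V) (hU : U.Nonempty) : ∃ (t : ℕ) (p : ℕ → ℕ) (M : V → ℕ → Prop),
      IsMinRep t p (U : Set V) M ∧
      ∀ i ∈ U, ∀ k ∈ U, i ≠ k → (G.Adj i k ↔ ∃ x, M i x ∧ M k x) := by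
  classical
  induction U using Finset.strongInduction with
  | H U ih =>
    obtain ⟨v, hv, hsimp⟩ := hG.exists_isSimplicialIn hU
    have hUv : (U : Set V) = insert v ((U.erase v : Finset V) : Set V) := by
      rw [← Finset.coe_insert, Finset.insert_erase hv]
    by_cases hne : (U.erase v).Nonempty
    swap
    · have hsingle : ∀ i ∈ U, i = v := by
        intro i hi
        by_contra h
        exact hne ⟨i, Finset.mem_erase.2 ⟨h, hi⟩⟩
      refine ⟨1, id, _, IsMinRep.single (U : Set V) ⟨v, hv⟩, fun i hi k hk hik => ?_⟩
      exact absurd ((hsingle i hi).trans (hsingle k hk).symm) hik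
    obtain ⟨t, p, M, hR, hM⟩ := ih (U.erase v) (Finset.erase_ssubset hv) hne
    have hvU : v ∉ ((U.erase v : Finset V) : Set V) := by simp
    have hMv : ∀ x, ¬ M v x := fun x h => hvU (hR.index_mem _ _ h)
    set K := (U.erase v).filter fun i => G.Adj v i with hKdef
    have hmemK : ∀ i, i ∈ K ↔ i ∈ U ∧ G.Adj v i := by
      intro i
      rw [hKdef, Finset.mem_filter, Finset.mem_erase]
      exact ⟨fun h => ⟨h.1.2, h.2⟩, fun h => ⟨⟨h.2.ne', h.1⟩, h.2⟩⟩
    obtain ⟨j, hj, hjK⟩ := hR.exists_common K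
      (fun i hi => Finset.mem_coe.2 (Finset.mem_filter.1 hi).1) (by
        intro i hi k hk
        by_cases hik : i = k
        · subst hik
          obtain ⟨r, hr, -⟩ := hR.root i (Finset.mem_coe.2 (Finset.mem_filter.1 hi).1)
          exact ⟨r, hr, hr⟩
        · rw [← hM i (Finset.mem_filter.1 hi).1 k (Finset.mem_filter.1 hk).1 hik]
          exact hsimp i ((hmemK i).1 hi).1 k ((hmemK k).1 hk).1 ((hmemK i).1 hi).2
            ((hmemK k).1 hk).2 hik)
    -- In both cases below, `v` meets exactly the members of `K`, and among the old subtrees only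
    -- members of `K` may gain a common node; these already meet in `j`.
    have hfinal : ∀ M' : V → ℕ → Prop,
        (∀ i, i ≠ v → ∀ k, k ≠ v → ((∃ x, M' i x ∧ M' k x) ↔ (∃ x, M i x ∧ M k x) ∨
          (i ∈ K ∧ k ∈ K))) →
        (∀ i, i ≠ v → ((∃ x, M' v x ∧ M' i x) ↔ i ∈ K)) →
        ∀ i ∈ U, ∀ k ∈ U, i ≠ k → (G.Adj i k ↔ ∃ x, M' i x ∧ M' k x) := by
      intro M' h1 h2 i hi k hk hik
      by_cases hiv : i = v
      · subst hiv
        rw [h2 k (Ne.symm hik), hmemK]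
        simp [hk]
      · by_cases hkv : k = v
        · subst hkv
          simp only [and_comm (a := M' i _)]
          rw [h2 i hik, hmemK, G.adj_comm]
          simp [hi]
        · rw [h1 i hiv k hkv, hM i (Finset.mem_erase.2 ⟨hiv, hi⟩) k
            (Finset.mem_erase.2 ⟨hkv, hk⟩) hik]
          constructor
          · exact Or.inl
          · rintro (h | ⟨h, h'⟩)
            · exact h
            · exact ⟨j, hjK _ h, hjK _ h'⟩
    by_cases hKj : ∃ i, M i j ∧ i ∉ K
    · refine ⟨t + 1, Function.update p t j, _,
        by
          have h := hR.leaf (S := (K : Set V)) (N := {v}) hj (fun i hi => hjK i hi) hKj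
            (Set.singleton_nonempty v) (by
              rintro i rfl
              exact hvU)
          rwa [Set.union_singleton, ← hUv] at h, ?_⟩
      have hMt : ∀ i, ¬ M i t := fun i h => absurd (hR.node_lt _ _ h) (lt_irrefl t)
      refine hfinal _ ?_ ?_
      · intro i hi k hk
        constructor
        · rintro ⟨x, h1 | ⟨rfl, h1⟩, h2 | ⟨hx, h2⟩⟩
          · exact Or.inl ⟨x, h1, h2⟩
          · exact absurd (hx ▸ h1) (hMt i)
          · exact absurd h2 (hMt k)
          · exact Or.inr ⟨h1.resolve_right hi, h2.resolve_right hk⟩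
        · rintro (⟨x, h1, h2⟩ | ⟨h1, h2⟩)
          · exact ⟨x, Or.inl h1, Or.inl h2⟩
          · exact ⟨t, Or.inr ⟨rfl, Or.inl h1⟩, Or.inr ⟨rfl, Or.inl h2⟩⟩
      · intro i hi
        constructor
        · rintro ⟨x, h1 | ⟨rfl, h1⟩, h2 | ⟨-, h2⟩⟩
          · exact absurd h1 (hMv x)
          · exact absurd h1 (hMv x)
          · exact absurd h2 (hMt i)
          · exact h2.resolve_right hi
        · intro h
          exact ⟨t, Or.inr ⟨rfl, Or.inr rfl⟩, Or.inr ⟨rfl, Or.inl h⟩⟩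
    · push Not at hKj
      -- Now the subtrees through `j` are exactly those of `K`. A leaf would violate `down`, and
      -- placing `v` on `j` itself creates exactly the required adjacencies.
      refine ⟨t, p, _, by
        have h := hR.insert_single hj hvU
        rwa [← hUv] at h, ?_⟩
      refine hfinal _ ?_ ?_
      · intro i hi k hk
        simp only [hi, hk, and_false, or_false]
        constructor
        · exact Or.inl
        · rintro (h | ⟨h1, h2⟩)
          · exact h
          · exact ⟨j, hjK _ h1, hjK _ h2⟩
      · intro i hi
        simp only [hi, and_false, or_false, hMv, false_or, and_true]
        constructor
        · rintro ⟨x, rfl, h⟩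
          exact hKj i h
        · intro h
          exact ⟨j, rfl, hjK i h⟩

/-! ## Executions of the algorithm -/

/-- All outcomes of an iteration, and all choices lead to an outcome. -/
theorem Stores.iteration {t c : ℕ} {p : ℕ → ℕ} {M : ℕ → ℕ → Prop} {m : Machine}
    (h : Stores t c p M m) (ht : 0 < t) (hM : ∀ x < t, ∃ i, M i x)
    (hpl : ∀ x, 0 < x → x < t → p x < x) {n : ℕ} (hcn : c < n) (D : RandomChoices) :
    (∀ r, Outcome (iteration D n) ⟨m.store, m.steps + 1⟩ r → ∃ j < t, ∃ k, 1 ≤ k ∧ c + k ≤ n ∧ ∃ S : Finset ℕ,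
      (∀ i ∈ S, M i j) ∧ (∃ i, M i j ∧ i ∉ S) ∧ ∀ (p' : ℕ → ℕ) (M' : ℕ → ℕ → Prop),
        (∀ x < t, p' x = p x) → p' t = j → (∀ i, ∀ x < t, M' i x ↔ M i x) →
        (∀ i, M' i t ↔ i ∈ S ∨ (c ≤ i ∧ i < c + k)) → Stores (t + 1) (c + k) p' M' r.2) ∧
    (∀ j < t, ∀ k, 1 ≤ k → c + k ≤ n → ∀ S : Finset ℕ,
      (∀ i ∈ S, M i j) → (∃ i, M i j ∧ i ∉ S) → ∃ r, Outcome (iteration D n) ⟨m.store, m.steps + 1⟩ r ∧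
        ∀ (p' : ℕ → ℕ) (M' : ℕ → ℕ → Prop),
        (∀ x < t, p' x = p x) → p' t = j → (∀ i, ∀ x < t, M' i x ↔ M i x) →
        (∀ i, M' i t ↔ i ∈ S ∨ (c ≤ i ∧ i < c + k)) → Stores (t + 1) (c + k) p' M' r.2) := by
  have hj : ∀ j, j ∈ (uniformOn m.store.T.V.toFinset).support ↔ j < t := by
    intro j
    rw [support_uniformOn ⟨0, List.mem_toFinset.2 ((h.nodes 0).2 ht)⟩]
    simp [h.nodes]
  have hk : ∀ k, k ∈ (D.number (n - m.store.count)).support ↔ 1 ≤ k ∧ c + k ≤ n := by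
    intro k
    rw [h.count, D.number_support _ (by omega), Set.mem_Icc]
    omega
  have hS : ∀ j < t, ∀ k l m₁, CopiesMade t k [] ⟨m.store, m.steps + 6⟩ l m₁ → ∀ S : Finset ℕ,
      S ∈ (D.subset (m₁.store.through j).toFinset).support ↔
        (∀ i ∈ S, M i j) ∧ ∃ i, M i j ∧ i ∉ S := by
    intro j hj k l m₁ h₁ S
    -- The copies are registered only at `t`, so the subset is still drawn from the old subtrees
    -- through `j`.
    have hth : m₁.store.through j = m.store.through j := by
      rw [h₁.through, Function.update_of_ne (by omega)]
    obtain ⟨i, hi⟩ := hM j hj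
    rw [hth, D.subset_support _ ⟨i, List.mem_toFinset.2 ((h.through j hj i).2 hi)⟩]
    simp only [Set.mem_ofPred_eq, Finset.ssubset_def, Finset.subset_iff, List.mem_toFinset,
      h.through j hj, not_forall, exists_prop]
  have hpl' : ∀ x, 0 < x → x < t → p x < t := fun x h1 h2 => (hpl x h1 h2).trans h2
  constructor
  · intro r hr
    rw [outcome_iteration, h.nodes_length] at hr
    obtain ⟨j, hj', k, hk', l, m₁, h₁, S, hS', h₂⟩ := hr
    have h₁' := copiesMade_of_outcome _ _ _ _ _ h₁
    have h₂' := extended_of_outcome _ _ _ _ S.nodup_toList _ _ h₂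
    rw [hj] at hj'
    rw [hk] at hk'
    rw [hS j hj' k l m₁ h₁'] at hS'
    exact ⟨j, hj', k, hk'.1, hk'.2, S, hS'.1, hS'.2, fun p' M' hp hpt hM' hMt =>
      h.leaf ht hk'.1 hj' hS'.1 hp hpt hM' hMt hpl' h₁' h₂'⟩
  · intro j hj' k hk1 hk2 S hS1 hS2
    obtain ⟨⟨l, m₁⟩, h₁⟩ := exists_outcome (newCopies t k []) ⟨m.store, m.steps + 6⟩
    have h₁' := copiesMade_of_outcome _ _ _ _ _ h₁
    obtain ⟨r, h₂⟩ := exists_outcome (forEach (fun i => do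
        exec (.subNode i t)
        exec (.subEdge i j t)
        exec (.register i t)
        forEach (fun u => exec (.edge i u)) l) S.toList)
        ⟨{ m₁.store with T := ⟨t :: m₁.store.T.V,
            (j, t) :: m₁.store.T.E⟩ }, m₁.steps + 3 + (1 + S.card)⟩
    have h₂' := extended_of_outcome _ _ _ _ S.nodup_toList _ _ h₂
    refine ⟨r, ?_, fun p' M' hp hpt hM' hMt =>
      h.leaf ht hk1 hj' hS1 hp hpt hM' hMt hpl' h₁' h₂'⟩
    rw [outcome_iteration, h.nodes_length]
    exact ⟨j, (hj j).2 hj', k, (hk k).2 ⟨hk1, hk2⟩, l, m₁, h₁, S,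
      (hS j hj' k l m₁ h₁' S).2 ⟨hS1, hS2⟩, h₂⟩

theorem outcome_mainLoop_succ (D : RandomChoices) (n f : ℕ) (m : Machine) (r : Bool × Machine) :
    Outcome (mainLoop D n (f + 1)) m r ↔
      if m.store.count < n then ∃ q, Outcome (iteration D n) ⟨m.store, m.steps + 1⟩ q ∧
        Outcome (mainLoop D n f) q.2 r
      else r = (true, ⟨m.store, m.steps + 1⟩) := by
  rw [mainLoop, outcome_look_bind]
  split_ifs with h
  · rw [outcome_bind]
  · rw [outcome_pure]

/-- Every execution of the main loop halts with a representation with `n` subtrees. -/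
theorem Stores.mainLoop_outcome {n : ℕ} (D : RandomChoices) (f : ℕ) :
    ∀ {t c : ℕ} {p : ℕ → ℕ} {M : ℕ → ℕ → Prop} {m : Machine}, Stores t c p M m →
      IsMinRep t p {i | i < c} M → c ≤ n → n + 1 ≤ f + c →
      ∀ r, Outcome (mainLoop D n f) m r → r.1 = true ∧ ∃ t p M m', IsMinRep t p {i | i < n} M ∧
        Stores t n p M m' ∧ r.2 = ⟨m'.store, m'.steps + 1⟩ := by
  induction f with
  | zero =>
    intro t c p M m _ _ h1 h2
    omega
  | succ f ih =>
    intro t c p M m h hR hc hf r hr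
    rw [outcome_mainLoop_succ, h.count] at hr
    by_cases hcn : c < n
    · rw [if_pos hcn] at hr
      obtain ⟨q, hq, hr⟩ := hr
      obtain ⟨j, hj, k, hk1, hk2, S, hS1, hS2, hnew⟩ :=
        (h.iteration hR.pos (fun x => hR.exists_mem) hR.parent_lt hcn D).1 q hq
      have hMt : ∀ i, ¬ M i t := fun i hi => absurd (hR.node_lt _ _ hi) (lt_irrefl t)
      have hR' := hR.leaf (S := (S : Set ℕ)) (N := {i | c ≤ i ∧ i < c + k}) hj hS1 hS2
        ⟨c, le_rfl, by omega⟩ fun i hi hi' => absurd hi.1 (not_le.2 hi')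
      have hI : ({i | i < c} ∪ {i | c ≤ i ∧ i < c + k} : Set ℕ) = {i | i < c + k} := by
        ext i
        simp only [Set.mem_union, Set.mem_ofPred_eq]
        omega
      rw [hI] at hR'
      -- Each iteration creates at least one subtree, so the fuel bound is preserved; the extra 1 in
      -- it pays for the final, failing test.
      refine ih (hnew _ _ ?_ ?_ ?_ ?_) hR' hk2 (by omega) r hr
      · intro x hx
        exact Function.update_of_ne (by omega) _ _
      · exact Function.update_self _ _ _
      · intro i x hx
        simp [hx.ne]
      · intro i
        simp [hMt]
    · rw [if_neg hcn] at hr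
      obtain rfl : c = n := by omega
      subst hr
      exact ⟨rfl, t, p, M, m, hR, h, rfl⟩

/-- If subtrees are numbered in the order of their roots, those that meet `0, …, τ - 1` come
first. -/
theorem exists_count_of_sorted {n : ℕ} {M : ℕ → ℕ → Prop}
    (hsort : ∀ i k x, i < k → k < n → M k x → ∃ y ≤ x, M i y) (τ : ℕ) :
    ∃ c, c ≤ n ∧ ∀ i, i < c ↔ i < n ∧ ∃ y < τ, M i y := by
  classical
  have hex : ∃ i, ¬ (i < n ∧ ∃ y < τ, M i y) := ⟨n, by simp⟩
  refine ⟨Nat.find hex, Nat.find_min' hex (by simp), fun i => ⟨fun hi => ?_, fun hi => ?_⟩⟩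
  · exact not_not.1 (Nat.find_min hex hi)
  · by_contra hlt
    refine Nat.find_spec hex ?_
    rcases (not_lt.1 hlt).lt_or_eq with hlt | heq
    · obtain ⟨h1, y, hy, h2⟩ := hi
      obtain ⟨z, hz, h3⟩ := hsort _ i y hlt h1 h2
      exact ⟨by omega, z, by omega, h3⟩
    · rwa [heq]

/-- A representation whose subtrees are numbered in the order of their roots is an outcome of the
main loop. -/
theorem Stores.mainLoop_reaches {n t : ℕ} {p : ℕ → ℕ} {M : ℕ → ℕ → Prop} (D : RandomChoices)
    (hR : IsMinRep t p {i | i < n} M)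
    (hsort : ∀ i k x, i < k → k < n → M k x → ∃ y ≤ x, M i y) (f : ℕ) :
    ∀ {τ c : ℕ} {m : Machine}, Stores τ c p M m → 0 < τ → τ ≤ t →
      (∀ i, i < c ↔ i < n ∧ ∃ y < τ, M i y) → n + 1 ≤ f + c →
      ∃ r, Outcome (mainLoop D n f) m r ∧ r.1 = true ∧ ∃ m', Stores t n p M m' ∧
        r.2 = ⟨m'.store, m'.steps + 1⟩ := by
  induction f with
  | zero =>
    intro τ c m _ _ _ hc hf
    have := ((hc n).1 (by omega)).1
    omega
  | succ f ih =>
    intro τ c m h hτ hτt hc hf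
    simp only [outcome_mainLoop_succ, h.count]
    have hcn' : c ≤ n := by
      by_contra hlt
      have := ((hc n).1 (by omega)).1
      omega
    by_cases hτ' : τ = t
    · subst hτ'
      have hcn : c = n := by
        by_contra hne
        obtain ⟨x, hx, -⟩ := hR.root c (show c < n by omega)
        have := (hc c).2 ⟨by omega, x, hR.node_lt _ _ hx, hx⟩
        omega
      subst hcn
      exact ⟨_, by rw [if_neg (lt_irrefl c)], rfl, m, h, rfl⟩
    obtain ⟨c', hc'n, hc'⟩ := exists_count_of_sorted hsort (τ + 1)
    obtain ⟨i₀, hi₀, hi₀'⟩ := hR.up τ hτ (by omega)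
    have hpτ := hR.parent_lt τ hτ (by omega)
    -- A subtree through `τ` that misses the parent of `τ` is rooted at `τ`, so it meets no earlier
    -- node and has not been created yet.
    have hbirth : ∀ i, M i τ → ¬ M i (p τ) → c ≤ i ∧ i < c' := by
      intro i h1 h2
      have hin := hR.index_mem _ _ h1
      refine ⟨?_, (hc' i).2 ⟨hin, τ, by omega, h1⟩⟩
      by_contra hlt
      obtain ⟨-, y, hy, h3⟩ := (hc i).1 (not_le.1 hlt)
      obtain ⟨r, -, hr⟩ := hR.root i hin
      have h4 := IsMinRep.root_lt_of_mem hr h3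
      exact h2 (hr τ h1 (by omega)).2
    have hcc' : c < c' := by
      have := hbirth i₀ hi₀ hi₀'
      omega
    have hcn : c < n := by omega
    simp only [if_pos hcn]
    have hMx : ∀ x < τ, ∃ i, M i x := fun x hx => hR.exists_mem (by omega)
    classical
    obtain ⟨q, hq, hnew⟩ := (h.iteration hτ hMx
      (fun x h1 h2 => hR.parent_lt x h1 (by omega)) hcn D).2 (p τ) hpτ (c' - c) (by omega)
      (by omega) ((Finset.range n).filter fun i => M i τ ∧ M i (p τ)) (by simp) (by
        obtain ⟨i, h1, h2⟩ := hR.down τ hτ (by omega)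
        exact ⟨i, h1, by simp [h2]⟩)
    -- `Stores` looks only at nodes below its first argument, so the target `p` and `M` serve at
    -- every stage.
    have hS := hnew p M (fun _ _ => rfl) rfl (fun _ _ _ => Iff.rfl) (by
      intro i
      rw [Finset.mem_filter, Finset.mem_range]
      constructor
      · intro h1
        by_cases h2 : M i (p τ)
        · exact Or.inl ⟨hR.index_mem _ _ h1, h1, h2⟩
        · have := hbirth i h1 h2
          exact Or.inr (by omega)
      · rintro (h1 | h1)
        · exact h1.2.1
        · obtain ⟨h2, y, hy, h3⟩ := (hc' i).1 (by omega)
          by_cases hyτ : y = τ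
          · exact hyτ ▸ h3
          · have := (hc i).2 ⟨h2, y, by omega, h3⟩
            omega)
    rw [show c + (c' - c) = c' by omega] at hS
    obtain ⟨r, hr, h1⟩ := ih hS (by omega) (by omega) hc' (by omega)
    exact ⟨r, ⟨q, hq, hr⟩, h1⟩

theorem outcome_generate (D : RandomChoices) (n : ℕ) (r : Bool × Machine) :
    Outcome (generateContractionMinimal D n) ⟨Store.empty, 0⟩ r ↔
      ∃ k ∈ (D.number n).support, ∃ l m₁,
        Outcome (newCopies 0 k []) ⟨Store.empty, 3⟩ (l, m₁) ∧
        Outcome (mainLoop D n n)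
          ⟨{ m₁.store with T := ⟨0 :: m₁.store.T.V, m₁.store.T.E⟩ }, m₁.steps + 1⟩ r := by
  rw [generateContractionMinimal, outcome_bind]
  simp only [outcome_newNode, outcome_exec_bind]
  constructor
  · rintro ⟨⟨⟨t, l⟩, m₁⟩, ⟨k, hk, ht, hq⟩, h⟩
    subst ht
    exact ⟨k, hk, l, m₁, hq, h⟩
  · rintro ⟨k, hk, l, m₁, hq, h⟩
    exact ⟨((0, l), m₁), ⟨k, hk, rfl, hq⟩, h⟩

/-- Every execution of the algorithm halts with a representation with `n` subtrees. -/
theorem outcome_of_mem_support_output {n : ℕ} (hn : 1 ≤ n) (D : RandomChoices)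
    (r : Bool × Machine) (hr : r ∈ (output D n).support) :
    r.1 = true ∧ ∃ t p M m', IsMinRep t p {i | i < n} M ∧ Stores t n p M m' ∧
      r.2 = ⟨m'.store, m'.steps + 1⟩ := by
  obtain ⟨k, hk, l, m₁, h₁, h⟩ := (outcome_generate D n r).1 hr
  rw [D.number_support n hn] at hk
  refine (stores_first (p := id) (M := fun i x => i < k ∧ x = 0) hk.1 (by simp)
    (copiesMade_of_outcome _ _ _ _ _ h₁)).mainLoop_outcome D n ?_ hk.2 ?_ r h
  · exact IsMinRep.single {i | i < k} ⟨0, hk.1⟩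
  · have := hk.1
    omega

/-- A representation whose subtrees are numbered in the order of their roots is an outcome of the
algorithm. -/
theorem exists_mem_support_output {n : ℕ} (D : RandomChoices) {t : ℕ} {p : ℕ → ℕ}
    {M : ℕ → ℕ → Prop} (hR : IsMinRep t p {i | i < n} M)
    (hsort : ∀ i k x, i < k → k < n → M k x → ∃ y ≤ x, M i y) :
    ∃ r ∈ (output D n).support, r.1 = true ∧ ∃ m', Stores t n p M m' ∧
      r.2 = ⟨m'.store, m'.steps + 1⟩ := by
  obtain ⟨i₀, hi₀⟩ := hR.nonempty
  have hn : i₀ < n := hR.index_mem _ _ hi₀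
  -- The first draw must be the number of subtrees through the root 0.
  obtain ⟨k, hkn, hk⟩ := exists_count_of_sorted hsort 1
  have hk1 : i₀ < k := (hk i₀).2 ⟨hn, 0, one_pos, hi₀⟩
  obtain ⟨⟨l, m₁⟩, h₁⟩ := exists_outcome (newCopies 0 k []) ⟨Store.empty, 3⟩
  have hM0 : ∀ i, M i 0 ↔ i < k := by
    intro i
    rw [hk]
    constructor
    · exact fun h => ⟨hR.index_mem _ _ h, 0, one_pos, h⟩
    · rintro ⟨-, y, hy, h⟩
      obtain rfl : y = 0 := by omega
      exact h
  obtain ⟨r, hr, h⟩ := (stores_first (p := p) (by omega) hM0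
    (copiesMade_of_outcome _ _ _ _ _ h₁)).mainLoop_reaches D hR hsort n one_pos hR.pos hk
    (by omega)
  refine ⟨r, (outcome_generate D n r).2 ⟨k, ?_, l, m₁, h₁, hr⟩, h⟩
  rw [D.number_support n (by omega)]
  exact ⟨by omega, hkn⟩

/-! ## Memories and representations -/

/-- The bijections `e` and `σ` permit two uses: with identities for the representation that an
execution builds, and with renamings for a prescribed one. -/
theorem Stores.encodes {W : Type*} {t n : ℕ} {p : ℕ → ℕ} {M : ℕ → ℕ → Prop} {m : Machine}
    (h : Stores t n p M m) (R : Representation W n) (e : W ≃ Fin t) (σ : Fin n ≃ Fin n)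
    (hT : ∀ a b, R.tree.Adj a b ↔
      (0 < (e b).val ∧ (e a).val = p (e b)) ∨ (0 < (e a).val ∧ (e b).val = p (e a)))
    (hV : ∀ i a, a ∈ (R.sub i).verts ↔ M (σ i) (e a))
    (hE : ∀ i a b, (R.sub i).Adj a b ↔ R.tree.Adj a b ∧ M (σ i) (e a) ∧ M (σ i) (e b))
    (hp : ∀ x, 0 < x → x < t → p x < x) :
    m.store.EncodesRep R (fun a => (e a).val) (fun i => (σ i).val) ∧
    m.store.EncodesGraph R.graph (fun i => (σ i).val) := by
  have hnum : ∀ i < n, ∃ k : Fin n, (σ k).val = i := fun i hi =>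
    ⟨σ.symm ⟨i, hi⟩, by simp⟩
  have hnode : ∀ x < t, ∃ a : W, (e a).val = x := fun x hx => ⟨e.symm ⟨x, hx⟩, by simp⟩
  have hinj : Function.Injective fun i => (σ i).val := Fin.val_injective.comp σ.injective
  refine ⟨⟨Fin.val_injective.comp e.injective, ⟨?_, ?_⟩, ⟨?_, hinj.injOn, ?_⟩, ?_⟩, hinj, ?_, ?_⟩
  · ext x
    simp only [Set.mem_ofPred_eq, h.nodes, SimpleGraph.Subgraph.verts_top, Set.image_univ,
      Set.mem_range]
    exact ⟨hnode x, fun ⟨a, ha⟩ => ha ▸ (e a).2⟩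
  · intro x y
    simp only [RawGraph.Joins, h.tree_edges, SimpleGraph.Subgraph.top_adj, hT]
    constructor
    · rintro (⟨h1, h2, h3⟩ | ⟨h1, h2, h3⟩)
      · obtain ⟨b, rfl⟩ := hnode y h2
        obtain ⟨a, ha⟩ := hnode x (h3 ▸ (hp _ h1 h2).trans h2)
        exact ⟨a, b, Or.inl ⟨h1, ha.trans h3⟩, ha, rfl⟩
      · obtain ⟨a, rfl⟩ := hnode x h2
        obtain ⟨b, hb⟩ := hnode y (h3 ▸ (hp _ h1 h2).trans h2)
        exact ⟨a, b, Or.inr ⟨h1, hb.trans h3⟩, rfl, hb⟩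
    · rintro ⟨a, b, h1 | h1, rfl, rfl⟩
      · exact Or.inl ⟨h1.1, (e b).2, h1.2⟩
      · exact Or.inr ⟨h1.1, (e a).2, h1.2⟩
  · intro i _
    change (σ i).val < m.store.count
    rw [h.count]
    exact (σ i).2
  · intro i hi
    obtain ⟨k, hk⟩ := hnum i (h.count ▸ hi)
    exact ⟨k, Set.mem_univ _, hk⟩
  · intro i
    refine ⟨?_, ?_⟩
    · ext x
      simp only [Set.mem_ofPred_eq, h.sub_nodes _ (σ i).2, Set.mem_image, hV]
      constructor
      · rintro ⟨h1, h2⟩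
        obtain ⟨a, rfl⟩ := hnode x h1
        exact ⟨a, h2, rfl⟩
      · rintro ⟨a, h1, rfl⟩
        exact ⟨(e a).2, h1⟩
    · intro x y
      simp only [RawGraph.Joins, h.sub_edges _ (σ i).2, hE, hT]
      constructor
      · rintro (⟨h1, h2, h3, h4, h5⟩ | ⟨h1, h2, h3, h4, h5⟩)
        · obtain ⟨b, rfl⟩ := hnode y h2
          obtain ⟨a, rfl⟩ := hnode x (h3 ▸ (hp _ h1 h2).trans h2)
          exact ⟨a, b, ⟨Or.inl ⟨h1, h3⟩, h4, h5⟩, rfl, rfl⟩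
        · obtain ⟨a, rfl⟩ := hnode x h2
          obtain ⟨b, rfl⟩ := hnode y (h3 ▸ (hp _ h1 h2).trans h2)
          exact ⟨a, b, ⟨Or.inr ⟨h1, h3⟩, h5, h4⟩, rfl, rfl⟩
      · rintro ⟨a, b, ⟨h1 | h1, h2, h3⟩, rfl, rfl⟩
        · exact Or.inl ⟨h1.1, (e b).2, h1.2, h2, h3⟩
        · exact Or.inr ⟨h1.1, (e a).2, h1.2, h3, h2⟩
  · ext i
    simp only [Set.mem_ofPred_eq, h.vertices, SimpleGraph.Subgraph.verts_top, Set.image_univ,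
      Set.mem_range]
    exact ⟨hnum i, fun ⟨k, hk⟩ => hk ▸ (σ k).2⟩
  · intro x y
    rw [h.joins]
    simp only [SimpleGraph.Subgraph.top_adj]
    constructor
    · rintro ⟨hne, z, hz, h1, h2⟩
      obtain ⟨i, rfl⟩ := hnum x (h.index_lt _ _ hz h1)
      obtain ⟨k, rfl⟩ := hnum y (h.index_lt _ _ hz h2)
      obtain ⟨a, rfl⟩ := hnode z hz
      refine ⟨i, k, ⟨?_, a, (hV i a).2 h1, (hV k a).2 h2⟩, rfl, rfl⟩
      rintro rfl
      exact hne rfl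
    · rintro ⟨i, k, ⟨hne, a, h1, h2⟩, rfl, rfl⟩
      exact ⟨hinj.ne hne, e a, (e a).2, (hV i a).1 h1, (hV k a).1 h2⟩

/-- No undirected edge is stored twice, so the stored list is no longer than the edge set; this
turns the step bound into one in terms of the graph. -/
theorem Stores.length_edges_le {V : Type*} [Finite V] {t n : ℕ} {p : ℕ → ℕ} {M : ℕ → ℕ → Prop}
    {m : Machine} (h : Stores t n p M m) {G : SimpleGraph V} {num : V → ℕ}
    (hG : m.store.EncodesGraph G num) : m.store.G.E.length ≤ G.edgeSet.ncard := by
  classical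
  have h1 : ((m.store.G.E.map fun e => s(e.1, e.2)).toFinset : Set (Sym2 ℕ)) ⊆
      Sym2.map num '' G.edgeSet := by
    intro e he
    simp only [List.coe_toFinset, List.mem_map, Set.mem_ofPred_eq] at he
    obtain ⟨⟨x, y⟩, hxy, rfl⟩ := he
    obtain ⟨a, b, hab, rfl, rfl⟩ := (hG.2.2 x y).1 (Or.inl hxy)
    exact ⟨s(a, b), hab, rfl⟩
  have h2 := Set.ncard_le_ncard h1 (Set.toFinite _)
  rw [Set.ncard_coe_finset, List.toFinset_card_of_nodup h.nodup, List.length_map] at h2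
  exact h2.trans (Set.ncard_image_le (Set.toFinite _))

/-! ## Rooting and ordering a given representation -/

/-- Shortest walks to `b` and `c`, prolonged to `a`, are paths from `r` to `a`. In a tree they
coincide, and so do their penultimate nodes. -/
theorem eq_of_adj_of_dist_lt {W : Type*} {T : SimpleGraph W} (hT : T.IsTree) {r a b c : W}
    (hb : T.Adj b a) (hc : T.Adj c a) (hdb : T.dist r b < T.dist r a)
    (hdc : T.dist r c < T.dist r a) : b = c := by
  have key : ∀ {b}, T.Adj b a → T.dist r b < T.dist r a →
      ∃ w : T.Walk r a, w.IsPath ∧ w.penultimate = b := by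
    intro b hb hd
    obtain ⟨q, hq⟩ := hT.connected.exists_walk_length_eq_dist r b
    refine ⟨q.concat hb, (q.concat hb).isPath_of_length_eq_dist ?_, q.penultimate_concat hb⟩
    rw [SimpleGraph.Walk.length_concat, hq]
    have := hT.dist_eq_dist_add_one_of_adj r hb
    omega
  obtain ⟨w, hw, rfl⟩ := key hb hdb
  obtain ⟨w', hw', rfl⟩ := key hc hdc
  have := (hT.isAcyclic.subsingleton_path r a).elim ⟨w, hw⟩ ⟨w', hw'⟩
  rw [Subtype.mk.injEq] at this
  rw [this]

theorem exists_adj_dist_lt {W : Type*} {T : SimpleGraph W} (hT : T.Connected) {r a : W}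
    (ha : a ≠ r) : ∃ b, T.Adj b a ∧ T.dist r b < T.dist r a := by
  obtain ⟨w, hw⟩ := hT.exists_walk_length_eq_dist r a
  have hpos := hT.pos_dist_of_ne ha.symm
  have hnil : ¬ w.Nil := by
    rw [← SimpleGraph.Walk.length_eq_zero_iff]
    omega
  refine ⟨w.penultimate, w.adj_penultimate hnil, ?_⟩
  have h1 := SimpleGraph.dist_le w.dropLast
  have h2 := w.length_dropLast_add_one hnil
  omega

/-- The nodes of a finite tree can be numbered such that every node but the first has exactly one
neighbour with a smaller number. -/
theorem exists_numbering {W : Type*} [Finite W] {T : SimpleGraph W} (hT : T.IsTree) :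
    ∃ (t : ℕ) (e : W ≃ Fin t) (p : ℕ → ℕ), 0 < t ∧ (∀ x, 0 < x → x < t → p x < x) ∧ p 0 = 0 ∧
      ∀ a b, T.Adj a b ↔ (0 < (e b).val ∧ (e a).val = p (e b)) ∨
        (0 < (e a).val ∧ (e b).val = p (e a)) := by
  classical
  obtain ⟨r⟩ := hT.connected.nonempty
  obtain ⟨t, ⟨e₀⟩⟩ := Finite.exists_equiv_fin W
  -- Sorting by distance from `r` puts parents before children.
  let σ := Tuple.sort fun x => T.dist r (e₀.symm x)
  have hmono : Monotone ((fun x => T.dist r (e₀.symm x)) ∘ σ) := Tuple.monotone_sort _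
  let e : W ≃ Fin t := e₀.trans σ.symm
  have hlt : ∀ a b, T.dist r a < T.dist r b → (e a).val < (e b).val := by
    intro a b hab
    by_contra hle
    have h1 := hmono (Fin.le_def.2 (not_lt.1 hle))
    simp only [Function.comp, e, Equiv.trans_apply, Equiv.apply_symm_apply,
      Equiv.symm_apply_apply] at h1
    omega
  have hr0 : ∀ a, a ≠ r → 0 < (e a).val := by
    intro a ha
    have h1 := hlt r a (by
      rw [SimpleGraph.dist_self]
      exact hT.connected.pos_dist_of_ne ha.symm)
    omega
  have hpar : ∀ a, ∃ b, a ≠ r → T.Adj b a ∧ T.dist r b < T.dist r a := by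
    intro a
    by_cases ha : a = r
    · exact ⟨a, fun h => absurd ha h⟩
    · obtain ⟨b, hb⟩ := exists_adj_dist_lt hT.connected ha
      exact ⟨b, fun _ => hb⟩
  choose P hP using hpar
  have ht : 0 < t := (Nat.zero_le _).trans_lt (e r).2
  have her : (e r).val = 0 := by
    by_contra hne
    have h1 : e.symm ⟨0, ht⟩ ≠ r := by
      intro h
      rw [← h] at hne
      simp at hne
    have := hr0 _ h1
    simp at this
  -- The default 0 makes the root its own parent, so iterating `p` below `t` never increases a
  -- number.
  let p : ℕ → ℕ := fun x => if h : 0 < x ∧ x < t then (e (P (e.symm ⟨x, h.2⟩))).val else 0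
  have hp : ∀ a, a ≠ r → p (e a) = e (P a) := by
    intro a ha
    have h : 0 < (e a).val ∧ (e a).val < t := ⟨hr0 a ha, (e a).2⟩
    simp only [p, dif_pos h, Fin.eta, Equiv.symm_apply_apply]
  have hne : ∀ a, 0 < (e a).val → a ≠ r := by
    rintro a h rfl
    omega
  refine ⟨t, e, p, ht, ?_, by simp [p], ?_⟩
  · intro x h1 h2
    obtain ⟨a, rfl⟩ : ∃ a, (e a).val = x := ⟨e.symm ⟨x, h2⟩, by simp⟩
    rw [hp a (hne a h1)]
    exact hlt _ _ (hP a (hne a h1)).2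
  · intro a b
    constructor
    · intro hab
      have key : ∀ a b, T.Adj a b → T.dist r a < T.dist r b →
          0 < (e b).val ∧ (e a).val = p (e b) := by
        intro a b hab hd
        have hb : b ≠ r := by
          rintro rfl
          simp at hd
        refine ⟨hr0 b hb, ?_⟩
        rw [hp b hb, eq_of_adj_of_dist_lt hT hab (hP b hb).1 hd (hP b hb).2]
      rcases hT.dist_eq_dist_add_one_of_adj r hab with h | h
      · exact Or.inr (key b a hab.symm (by omega))
      · exact Or.inl (key a b hab (by omega))
    · have key : ∀ a b, 0 < (e b).val → (e a).val = p (e b) → T.Adj a b := by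
        intro a b hb hab
        rw [hp b (hne b hb)] at hab
        rw [e.injective (Fin.ext hab)]
        exact (hP b (hne b hb)).1
      rintro (h | h)
      · exact key a b h.1 h.2
      · exact (key b a h.1 h.2).symm

/-- A subtree that contains the node `a` and an earlier one contains the edge from `a` to its
parent. -/
theorem exists_parent_adj {W : Type*} {T : SimpleGraph W} {t : ℕ} {e : W ≃ Fin t} {p : ℕ → ℕ}
    (hp : ∀ x, 0 < x → x < t → p x < x) (hp0 : p 0 = 0)
    (hT : ∀ a b, T.Adj a b → (0 < (e b).val ∧ (e a).val = p (e b)) ∨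
      (0 < (e a).val ∧ (e b).val = p (e a)))
    {H : T.Subgraph} (hH : H.Connected) {a c : W} (ha : a ∈ H.verts) (hc : c ∈ H.verts)
    (hca : (e c).val < e a) : ∃ b, (e b).val = p (e a) ∧ H.Adj b a := by
  obtain ⟨w⟩ := (SimpleGraph.Subgraph.connected_iff'.1 hH).preconnected ⟨a, ha⟩ ⟨c, hc⟩
  have hple : ∀ x < t, p x ≤ x := by
    intro x hx
    rcases Nat.eq_zero_or_pos x with rfl | h0
    · exact hp0.le
    · exact (hp x h0 hx).le
  have hiter : ∀ m x, x < t → p^[m] x ≤ x := by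
    intro m
    induction m with
    | zero => exact fun x _ => le_rfl
    | succ m ih =>
      intro x hx
      rw [Function.iterate_succ_apply]
      exact (ih _ ((hple x hx).trans_lt hx)).trans (hple x hx)
  -- The walk in `H` starts among the descendants of `a` and ends outside, since every descendant
  -- has a number at least that of `a`. The only tree edge that leaves the descendants joins `a` to
  -- its parent.
  obtain ⟨d, -, ⟨m, hm⟩, hd2⟩ := w.exists_boundary_dart
    {u | ∃ m, p^[m] (e u.1).val = (e a).val} ⟨0, rfl⟩ (by
      rintro ⟨m, hm⟩
      have := hiter m (e c) (e c).2
      simp only at hm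
      omega)
  have hadj : H.Adj d.fst.1 d.snd.1 := d.adj
  rcases hT _ _ (H.adj_sub hadj) with h | h
  · refine absurd ⟨m + 1, ?_⟩ hd2
    rw [Function.iterate_succ_apply, ← h.2]
    exact hm
  · cases m with
    | zero =>
      have hda : d.fst.1 = a := e.injective (Fin.ext hm)
      refine ⟨d.snd.1, by rw [h.2, hda], ?_⟩
      rw [← hda]
      exact hadj.symm
    | succ m =>
      refine absurd ⟨m, ?_⟩ hd2
      rw [Function.iterate_succ_apply] at hm
      rw [h.2]
      exact hm

/-- In a contraction-minimal representation, the set of subtrees through a node is not contained in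
the one of a neighbour. -/
theorem Representation.ContractionMinimal.exists_mem_not_mem {W : Type*} {n : ℕ}
    {R : Representation W n} (hR : R.ContractionMinimal) {a b : W} (hab : R.tree.Adj a b) :
    ∃ i, a ∈ (R.sub i).verts ∧ b ∉ (R.sub i).verts := by
  -- Otherwise every subtree through `a` contains `b`, so subtrees that meet in the merged node
  -- already met in `b` or in a common node.
  by_contra! hall
  refine hR s(a, b) hab ?_
  ext i k
  refine and_congr_right fun _ => ⟨?_, ?_⟩
  · rintro ⟨_, ⟨x, hx, rfl⟩, ⟨y, hy, hxy⟩⟩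
    have hb : ∀ {i z}, z ∈ (R.sub i).verts → z ∈ s(a, b) → b ∈ (R.sub i).verts := by
      intro i z hz hzab
      rcases Sym2.mem_iff.1 hzab with rfl | rfl
      · exact hall i hz
      · exact hz
    rcases Quotient.exact hxy with rfl | ⟨h1, h2⟩
    · exact ⟨y, hx, hy⟩
    · exact ⟨b, hb hx h2, hb hy h1⟩
  · rintro ⟨x, h1, h2⟩
    exact ⟨Quotient.mk _ x, ⟨x, h1, rfl⟩, ⟨x, h2, rfl⟩⟩

/-- A contraction-minimal representation in terms of parents. -/
theorem Representation.ContractionMinimal.exists_isMinRep {W : Type*} [Finite W] {n : ℕ}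
    (hn : 1 ≤ n) {R : Representation W n} (hR : R.ContractionMinimal) :
    ∃ (t : ℕ) (e : W ≃ Fin t) (σ : Fin n ≃ Fin n) (p : ℕ → ℕ) (M : ℕ → ℕ → Prop),
      IsMinRep t p {i | i < n} M ∧
      (∀ i k x, i < k → k < n → M k x → ∃ y ≤ x, M i y) ∧
      (∀ a b, R.tree.Adj a b ↔
        (0 < (e b).val ∧ (e a).val = p (e b)) ∨ (0 < (e a).val ∧ (e b).val = p (e a))) ∧
      (∀ i a, a ∈ (R.sub i).verts ↔ M (σ i) (e a)) ∧
      ∀ i a b, (R.sub i).Adj a b ↔ R.tree.Adj a b ∧ M (σ i) (e a) ∧ M (σ i) (e b) := by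
  classical
  obtain ⟨t, e, p, ht, hp, hp0, hT⟩ := exists_numbering R.isTree
  have hroot : ∀ i, ∃ r : W, r ∈ (R.sub i).verts ∧ ∀ a ∈ (R.sub i).verts,
      (e r).val ≤ (e a).val := by
    intro i
    obtain ⟨r, hr, h⟩ := Set.exists_min_image (R.sub i).verts (fun a => (e a).val)
      (Set.toFinite _) (R.connected i).nonempty
    exact ⟨r, hr, h⟩
  choose r hr hrmin using hroot
  -- `τ` lists the subtrees by increasing root, so a subtree gets its position `τ.symm` as number.
  let τ : Equiv.Perm (Fin n) := Tuple.sort fun i => (e (r i)).val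
  have hmono : Monotone ((fun i => (e (r i)).val) ∘ τ) := Tuple.monotone_sort _
  let M : ℕ → ℕ → Prop := fun i x =>
    ∃ (hi : i < n) (hx : x < t), e.symm ⟨x, hx⟩ ∈ (R.sub (τ ⟨i, hi⟩)).verts
  have hM : ∀ i a, M (τ.symm i) (e a) ↔ a ∈ (R.sub i).verts := by
    intro i a
    simp [M]
  have hM' : ∀ i x, M i x → ∃ (k : Fin n) (a : W), i = τ.symm k ∧ x = e a ∧
      a ∈ (R.sub k).verts := by
    rintro i x ⟨hi, hx, h⟩
    exact ⟨_, _, by simp, by simp, h⟩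
  have hnode : ∀ x < t, ∃ a : W, x = (e a).val := fun x hx => ⟨e.symm ⟨x, hx⟩, by simp⟩
  have hstep : ∀ k a, a ∈ (R.sub k).verts → a ≠ r k → (e (r k)).val < e a ∧
      ∃ b, (e b).val = p (e a) ∧ (R.sub k).Adj b a := by
    intro k a ha hne
    have hlt : (e (r k)).val < e a := lt_of_le_of_ne (hrmin k a ha) fun h =>
      hne (e.injective (Fin.ext h)).symm
    exact ⟨hlt, exists_parent_adj hp hp0 (fun a b => (hT a b).1) (R.connected k) ha (hr k) hlt⟩
  have hdu : ∀ x, 0 < x → x < t → ∃ a b, x = (e b).val ∧ p x = (e a).val ∧ R.tree.Adj a b := by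
    intro x h1 h2
    obtain ⟨b, rfl⟩ := hnode x h2
    obtain ⟨a, ha⟩ := hnode (p (e b)) ((hp _ h1 h2).trans h2)
    exact ⟨a, b, rfl, ha, (hT a b).2 (Or.inl ⟨h1, ha.symm⟩)⟩
  have hdown : ∀ x, 0 < x → x < t → ∃ i, M i (p x) ∧ ¬ M i x := by
    intro x h1 h2
    obtain ⟨a, b, hx, hpx, hab⟩ := hdu x h1 h2
    obtain ⟨i, hi, hi'⟩ := hR.exists_mem_not_mem hab
    refine ⟨τ.symm i, ?_, ?_⟩
    · rw [hpx, hM]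
      exact hi
    · rw [hx, hM]
      exact hi'
  refine ⟨t, e, τ.symm, p, M, ⟨ht, hp, ?_, ?_, ?_, hdown, ?_, ?_⟩, ?_, hT,
    fun i a => (hM i a).symm, ?_⟩
  · rintro i x ⟨-, hx, -⟩
    exact hx
  · rintro i x ⟨hi, -, -⟩
    exact hi
  · intro i hi
    obtain ⟨k, hk⟩ : ∃ k, i = (τ.symm k).val := ⟨τ ⟨i, hi⟩, by simp⟩
    subst hk
    refine ⟨e (r k), (hM _ _).2 (hr k), fun x hx hne => ?_⟩
    obtain ⟨a, rfl⟩ := hnode x hx.2.1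
    have ha := (hM _ _).1 hx
    obtain ⟨h1, b, h2, h3⟩ := hstep k a ha (by
      rintro rfl
      exact hne rfl)
    refine ⟨h1, ?_⟩
    rw [← h2, hM]
    exact (R.sub k).edge_vert h3
  · intro x h1 h2
    obtain ⟨a, b, hx, hpx, hab⟩ := hdu x h1 h2
    obtain ⟨i, hi, hi'⟩ := hR.exists_mem_not_mem hab.symm
    refine ⟨τ.symm i, ?_, ?_⟩
    · rw [hx, hM]
      exact hi
    · rw [hpx, hM]
      exact hi'
  -- Node 0 is the parent of node 1, so `down` provides a subtree through it. If 0 is the only node,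
  -- any of the `n ≥ 1` subtrees will do.
  · by_cases h1 : 1 < t
    · have h2 := hp 1 one_pos h1
      obtain ⟨i, hi, -⟩ := hdown 1 one_pos h1
      exact ⟨i, by rwa [Nat.lt_one_iff.1 h2] at hi⟩
    · have h2 := (hM ⟨0, hn⟩ (r ⟨0, hn⟩)).2 (hr _)
      have h3 : (e (r ⟨0, hn⟩)).val = 0 := by omega
      exact ⟨_, h3 ▸ h2⟩
  · rintro i k x hik hkn ⟨hk, hx, h⟩
    refine ⟨(e (r (τ ⟨i, by omega⟩))).val, ?_, by omega, (e _).2, ?_⟩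
    · have h1 := hmono (show (⟨i, by omega⟩ : Fin n) ≤ ⟨k, hk⟩ from hik.le)
      have h2 := hrmin _ _ h
      simp only [Function.comp, Equiv.apply_symm_apply] at h1 h2
      omega
    · simpa using hr _
  · intro i a b
    rw [hM, hM]
    constructor
    · exact fun h => ⟨h.adj_sub, (R.sub i).edge_vert h, (R.sub i).edge_vert h.symm⟩
    · rintro ⟨hab, ha, hb⟩
      -- A connected subgraph of a tree is induced: it contains the edge from a node to its parent
      -- whenever it contains both.
      have key : ∀ a b, a ∈ (R.sub i).verts → b ∈ (R.sub i).verts → 0 < (e b).val →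
          (e a).val = p (e b) → (R.sub i).Adj a b := by
        intro a b ha hb h1 h2
        have hlt : (e a).val < e b := h2 ▸ hp _ h1 (e b).2
        obtain ⟨c, hc, hcb⟩ := exists_parent_adj hp hp0 (fun a b => (hT a b).1) (R.connected i)
          hb ha hlt
        rwa [e.injective (Fin.ext (h2.trans hc.symm))]
      rcases (hT a b).1 hab with h | h
      · exact key a b ha hb h.1 h.2
      · exact (key b a hb ha h.1 h.2).symm

theorem Representation.ContractionMinimal.output_pos {W : Type*} [Finite W] {n : ℕ} (hn : 1 ≤ n)
    {R : Representation W n} (hR : R.ContractionMinimal) (D : RandomChoices) :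
    0 < (output D n).toOuterMeasure
      {x | x.1 = true ∧ ∃ (node : W → ℕ) (num : Fin n → ℕ),
        x.2.store.EncodesRep R node num ∧ x.2.store.EncodesGraph R.graph num} := by
  obtain ⟨t, e, σ, p, M, hmin, hsort, hT, hV, hE⟩ := hR.exists_isMinRep hn
  obtain ⟨x, hx, h1, m', hS, h2⟩ := exists_mem_support_output D hmin hsort
  rw [pos_iff_ne_zero, Ne, PMF.toOuterMeasure_apply_eq_zero_iff, Set.not_disjoint_iff]
  refine ⟨x, hx, h1, fun a => (e a).val, fun i => (σ i).val, ?_⟩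
  rw [h2]
  exact hS.encodes R e σ hT hV hE hmin.parent_lt

/-- Restriction of the index set from numbers to `Fin n`. -/
theorem IsMinRep.restrict {n t : ℕ} {p : ℕ → ℕ} {M : ℕ → ℕ → Prop}
    (hR : IsMinRep t p {i | i < n} M) :
    IsMinRep t p Set.univ fun (i : Fin n) x => M i x where
  pos := hR.pos
  parent_lt := hR.parent_lt
  node_lt i := hR.node_lt i
  index_mem i _ _ := Set.mem_univ i
  root i _ := hR.root i i.2
  down x h1 h2 := by
    obtain ⟨i, h⟩ := hR.down x h1 h2
    exact ⟨⟨i, hR.index_mem _ _ h.1⟩, h⟩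
  up x h1 h2 := by
    obtain ⟨i, h⟩ := hR.up x h1 h2
    exact ⟨⟨i, hR.index_mem _ _ h.1⟩, h⟩
  nonempty := by
    obtain ⟨i, h⟩ := hR.nonempty
    exact ⟨⟨i, hR.index_mem _ _ h⟩, h⟩

end ChordalGen

/-! ### The three assertions on the algorithm. -/

theorem mainTheorem3 :
    -- every execution halts with a contraction-minimal representation and its chordal graph,
    -- after a number of steps that is linear in the number of vertices and edges
    (∃ C : ℕ, ∀ (D : ChordalGen.RandomChoices) (n : ℕ), 1 ≤ n →
      ∀ x ∈ (ChordalGen.output D n).support,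
        x.1 = true ∧
        ∃ (t : ℕ) (R : ChordalGen.Representation (Fin t) n) (G : SimpleGraph (Fin n)),
          x.2.store.EncodesRep R Fin.val Fin.val ∧
          x.2.store.EncodesGraph G Fin.val ∧
          R.ContractionMinimal ∧
          R.graph = G ∧
          ChordalGen.IsChordal G ∧
          x.2.steps ≤ C * (n + G.edgeSet.ncard)) ∧
    -- every contraction-minimal representation with `n` subtrees has positive probability
    (∀ (D : ChordalGen.RandomChoices) (n : ℕ), 1 ≤ n →
      ∀ (W : Type*) [Finite W] (R : ChordalGen.Representation W n), R.ContractionMinimal →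
        0 < (ChordalGen.output D n).toOuterMeasure
          {x | x.1 = true ∧ ∃ (node : W → ℕ) (num : Fin n → ℕ),
            x.2.store.EncodesRep R node num ∧ x.2.store.EncodesGraph R.graph num}) ∧
    -- every chordal graph on `n` vertices has positive probability
    (∀ (D : ChordalGen.RandomChoices) (n : ℕ), 1 ≤ n →
      ∀ G : SimpleGraph (Fin n), ChordalGen.IsChordal G →
        0 < (ChordalGen.output D n).toOuterMeasure
          {x | x.1 = true ∧ ∃ num : Fin n → ℕ, x.2.store.EncodesGraph G num}) := by
  -- The steps number at most 18n + 8m plus 1 for the last loop test, and 1 ≤ n.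
  refine ⟨⟨19, fun D n hn x hx => ?_⟩, fun D n hn W _ R hR => hR.output_pos hn D,
    fun D n hn G hG => ?_⟩
  · obtain ⟨h1, t, p, M, m', hmin, hS, h2⟩ := ChordalGen.outcome_of_mem_support_output hn D x hx
    have hR := hmin.restrict
    have henc := hS.encodes hR.rep (Equiv.refl _) (Equiv.refl _) (fun a b => Iff.rfl)
      (fun i a => Iff.rfl) (fun i a b => ?_) hmin.parent_lt
    · refine ⟨h1, t, hR.rep, hR.rep.graph, ?_, ?_, hR.rep_contractionMinimal, rfl,
        hR.isChordal (fun i => Set.mem_univ i) hR.rep_graph_adj, ?_⟩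
      · rw [h2]
        exact henc.1
      · rw [h2]
        exact henc.2
      · have h3 := hS.length_edges_le henc.2
        have h4 := hS.steps
        rw [h2]
        simp only
        omega
    · exact ⟨fun h => ⟨h.2.2, h.1, h.2.1⟩, fun h => ⟨h.2.1, h.2.2, h.1⟩⟩
  · obtain ⟨t, p, M, hR, hM⟩ := hG.exists_isMinRep Finset.univ ⟨⟨0, hn⟩, Finset.mem_univ _⟩
    rw [Finset.coe_univ] at hR
    have hgraph : hR.rep.graph = G := by
      ext i k
      rw [hR.rep_graph_adj]
      constructor
      · rintro ⟨hne, h⟩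
        exact (hM i (Finset.mem_univ _) k (Finset.mem_univ _) hne).2 h
      · intro h
        exact ⟨h.ne, (hM i (Finset.mem_univ _) k (Finset.mem_univ _) h.ne).1 h⟩
    -- Storing this representation together with its graph is a special case of storing `G`.
    refine (hR.rep_contractionMinimal.output_pos hn D).trans_le
      ((ChordalGen.output D n).toOuterMeasure.mono ?_)
    rintro x ⟨h1, node, num, -, h2⟩
    exact ⟨h1, num, hgraph ▸ h2⟩
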